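/- Let $\lambda_1>\lambda_2>\dots>\lambda_n$ be real numbers and $\Lambda=\mathrm{diag}(\lambda_1,\dots,\lambda_n)$. Let $\mathcal O_\Lambda$ be the set of real symmetric $n\times n$ matrices with the same spectrum as $\Lambda$; every $S\in\mathcal O_\Lambda$ can be written $S=Q^T\Lambda Q$ with $Q\in SO(n,\mathbb R)$. The BFR map $F:\mathcal O_\Lambda\to\mathbb R^n$ sends $S=Q^T\Lambda Q$ to the diagonal of $Q\Lambda Q^T$, which does not depend on the choice of $Q$. For $S\in\mathcal O_\Lambda$ the slice through $S$ is $$\mathcal F_S=\{Q^TSQ:\ Q\in SO(n,\mathbb R)\}\cap\{RSR^{-1}:\ R\in Up^+(n,\mathbb R)\},$$ where $Up^+(n,\mathbb R)$ is the group of upper triangular matrices with positive diagonal entries. Let $\mathcal P_\Lambda$ be the permutohedron, the convex hull of the points $(\lambda_{\pi(1)},\dots,\lambda_{\pi(n)})$, where $\pi$ runs over all permutations of $\{1,\dots,n\}$. The matrix $S=Q^T\Lambda Q$ is spectrally complete if every minor of $Q$ formed by arbitrary $k$ rows and the first $k$ columns ($1\le k\le n$) is nonzero. (1) If $S\in\mathcal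 O_\Lambda$ is spectrally complete, then $\overline{\mathcal F_S}\subset\mathcal O_\Lambda$, and the restriction of $F$ to $\overline{\mathcal F_S}$ is a homeomorphism onto $\mathcal P_\Lambda$, which is a diffeomorphism between the interiors, that is, from $\mathcal F_S$ (the interior of $\overline{\mathcal F_S}$) onto the relative interior of $\mathcal P_\Lambda$. (2) Let $\mathcal J_\Lambda$ be the set of Jacobi matrices (real symmetric tridiagonal matrices with strictly positive entries immediately above and below the diagonal) with the same spectrum as $\Lambda$. Every $J\in\mathcal J_\Lambda$ is spectrally complete, and $\mathcal F_J=\mathcal J_\Lambda$. Consequently (Bloch–Flaschka–Ratiu) the restriction of $F$ to $\overline{\mathcal J_\Lambda}$ (a subset of $\mathcal O_\Lambda$) is a homeomorphism onto $\mathcal P_\Lambda$, which is a diffeomorphism from $\mathcal J_\Lambda$ onto the relative interior of $\mathcal P_\Lambda$. -/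

import Mathlib

open scoped ContDiff Matrix

attribute [local instance] Matrix.normedAddCommGroup Matrix.normedSpace

noncomputable section

namespace BFR

/-! ### Smooth maps and diffeomorphisms between subsets of normed spaces -/

section Smooth

variable {E F : Type*} [NormedAddCommGroup E] [NormedSpace ℝ E]
  [NormedAddCommGroup F] [NormedSpace ℝ F]

/-- `f` is smooth on the (arbitrary) subset `X`: near every point of `X` it coincides on `X` with a
smooth map defined on an open subset of the ambient space. -/
def SmoothOnSubset (f : E → F) (X : Set E) : Prop :=
  ∀ x ∈ X, ∃ U : Set E, IsOpen U ∧ x ∈ U ∧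
    ∃ g : E → F, ContDiffOn ℝ ∞ g U ∧ Set.EqOn f g (X ∩ U)

/-- `f` restricts to a diffeomorphism of the subset `X` onto the subset `Y`: a bijection, smooth,
with smooth inverse. (If `Y` is an open subset of an affine subspace of dimension `d`, this forces
`X` to be an embedded smooth submanifold of dimension `d`.) -/
def IsDiffeoBetween (f : E → F) (X : Set E) (Y : Set F) : Prop :=
  Set.BijOn f X Y ∧ SmoothOnSubset f X ∧
    ∃ g : F → E, Set.InvOn g f X Y ∧ SmoothOnSubset g Y

end Smooth

variable {n : ℕ}

/-- `𝒪_Λ`: the real symmetric matrices with the same spectrum, with multiplicities, as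
`Λ = diag(lam)`. -/
def isospectral (lam : Fin n → ℝ) : Set (Matrix (Fin n) (Fin n) ℝ) :=
  {S | S.IsSymm ∧ S.charpoly = (Matrix.diagonal lam).charpoly}

/-- `S = Qᵀ Λ Q` with `Q ∈ SO(n, ℝ)`. -/
def IsSpectralDecomp (lam : Fin n → ℝ) (S Q : Matrix (Fin n) (Fin n) ℝ) : Prop :=
  Q ∈ Matrix.specialOrthogonalGroup (Fin n) ℝ ∧ S = Qᵀ * Matrix.diagonal lam * Q

open Classical in
/-- The Bloch–Flaschka–Ratiu map: `F(S)` is the diagonal of `Q Λ Qᵀ`, where `S = Qᵀ Λ Q` with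
`Q ∈ SO(n, ℝ)`. It is meant on `𝒪_Λ`, where such a `Q` exists (`mem_isospectral_iff`) and the
value does not depend on its choice (`bfrMap_eq`); elsewhere the value is `0`. -/
def bfrMap (lam : Fin n → ℝ) (S : Matrix (Fin n) (Fin n) ℝ) : Fin n → ℝ :=
  if h : ∃ Q, IsSpectralDecomp lam S Q then
    Matrix.diag (h.choose * Matrix.diagonal lam * h.chooseᵀ)
  else 0

/-- The group `Up⁺(n, ℝ)` of upper triangular matrices with positive diagonal. -/
def upPos (n : ℕ) : Set (Matrix (Fin n) (Fin n) ℝ) :=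
  {R | (∀ i j, j < i → R i j = 0) ∧ ∀ i, 0 < R i i}

/-- The slice `ℱ_S` through `S`. -/
def slice (S : Matrix (Fin n) (Fin n) ℝ) : Set (Matrix (Fin n) (Fin n) ℝ) :=
  {T | ∃ Q ∈ Matrix.specialOrthogonalGroup (Fin n) ℝ, T = Qᵀ * S * Q} ∩
    {T | ∃ R ∈ upPos n, T = R * S * R⁻¹}

/-- `S = Qᵀ Λ Q` is spectrally complete: every `k × k` minor of `Q` formed by arbitrary `k` rows
and the first `k` columns is nonzero. -/
def SpectrallyComplete (lam : Fin n → ℝ) (S : Matrix (Fin n) (Fin n) ℝ) : Prop :=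
  ∃ Q, IsSpectralDecomp lam S Q ∧
    ∀ (k : ℕ) (hk : k ≤ n) (rows : Fin k ↪o Fin n),
      (Q.submatrix rows (Fin.castLE hk)).det ≠ 0

/-- The permutohedron `𝒫_Λ`: the convex hull of all points `(lam_{π(1)}, …, lam_{π(n)})`. -/
def permutohedron (lam : Fin n → ℝ) : Set (Fin n → ℝ) :=
  convexHull ℝ (Set.range fun π : Equiv.Perm (Fin n) => fun i => lam (π i))

/-- Jacobi matrices: real symmetric tridiagonal, with positive entries immediately below and above
the diagonal. -/
def IsJacobi (J : Matrix (Fin n) (Fin n) ℝ) : Prop :=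
  J.IsSymm ∧ (∀ i j : Fin n, (i : ℕ) + 1 < j → J i j = 0) ∧
    ∀ i j : Fin n, (i : ℕ) + 1 = j → 0 < J i j

/-- `𝒥_Λ`: the Jacobi matrices with spectrum `Λ`. -/
def jacobiSet (lam : Fin n → ℝ) : Set (Matrix (Fin n) (Fin n) ℝ) :=
  {J | IsJacobi J ∧ J ∈ isospectral lam}

/-- The BFR map is defined on the closure of `X` and restricts to a homeomorphism of that closure
onto the permutohedron `𝒫_Λ`, which is a diffeomorphism of `X` onto the relative interior
of `𝒫_Λ`. -/
def BFRHomeoOntoPermutohedron (lam : Fin n → ℝ) (X : Set (Matrix (Fin n) (Fin n) ℝ)) : Prop :=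
  closure X ⊆ isospectral lam ∧
  (∃ e : closure X ≃ₜ permutohedron lam, ∀ T : closure X, (e T : Fin n → ℝ) = bfrMap lam T) ∧
  IsDiffeoBetween (bfrMap lam) X (intrinsicInterior ℝ (permutohedron lam))

/-! ### The BFR map is well defined -/

theorem mem_isospectral_iff (lam : Fin n → ℝ) (S : Matrix (Fin n) (Fin n) ℝ) :
    S ∈ isospectral lam ↔ ∃ Q, IsSpectralDecomp lam S Q := by
  constructor
  · rintro ⟨hS, hc⟩
    have hA : S.IsHermitian := by simpa [Matrix.IsHermitian, Matrix.IsSymm] using hS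
    have hB : (Matrix.diagonal lam).IsHermitian := by
      simp [Matrix.IsHermitian]
    have he := (Matrix.IsHermitian.eigenvalues_eq_eigenvalues_iff hA hB).2 hc
    have h1 := hA.spectral_theorem
    have h2 := hB.spectral_theorem
    rw [he] at h1
    rw [Unitary.conjStarAlgAut_apply] at h1 h2
    set U : Matrix (Fin n) (Fin n) ℝ := (hA.eigenvectorUnitary).1 with hU
    set V : Matrix (Fin n) (Fin n) ℝ := (hB.eigenvectorUnitary).1 with hV
    have hUU : star U * U = 1 := Unitary.coe_star_mul_self hA.eigenvectorUnitary
    have hVV : star V * V = 1 := Unitary.coe_star_mul_self hB.eigenvectorUnitary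
    have hVV' : V * star V = 1 := Unitary.coe_mul_star_self hB.eigenvectorUnitary
    set Δ : Matrix (Fin n) (Fin n) ℝ := Matrix.diagonal ((RCLike.ofReal : ℝ → ℝ) ∘ hB.eigenvalues)
    have st : ∀ M : Matrix (Fin n) (Fin n) ℝ, star M = Mᵀ := fun M => by
      simp [Matrix.star_eq_conjTranspose]
    set P := V * star U with hP
    have hPP : Pᵀ * P = 1 := by
      rw [← st, hP, star_mul, star_star, mul_assoc, ← mul_assoc (star V), hVV, one_mul]
      exact (mul_eq_one_comm).1 hUU
    have hSP : S = Pᵀ * Matrix.diagonal lam * P := by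
      rw [h2, ← st, hP, star_mul, star_star]
      calc S = U * Δ * star U := h1
        _ = U * (star V * V) * Δ * (star V * V) * star U := by simp [hVV]
        _ = _ := by simp only [mul_assoc]
    have hdet : P.det = 1 ∨ P.det = -1 := by
      have := congrArg Matrix.det hPP
      rw [Matrix.det_mul, Matrix.det_transpose, Matrix.det_one] at this
      exact mul_self_eq_one_iff.1 this
    rcases hdet with hd | hd
    · refine ⟨P, ?_, hSP⟩
      rw [Matrix.mem_specialOrthogonalGroup_iff, Matrix.mem_orthogonalGroup_iff']
      exact ⟨hPP, hd⟩
    · have hn : Nonempty (Fin n) := by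
        by_contra h
        rw [not_nonempty_iff] at h
        rw [Matrix.det_isEmpty] at hd
        norm_num at hd
      obtain ⟨i0⟩ := hn
      set d : Fin n → ℝ := Function.update 1 i0 (-1) with hdd
      have hd2 : ∀ i, d i * d i = 1 := fun i => by
        by_cases h : i = i0
        · subst h; simp [hdd]
        · simp [hdd, h]
      have hEE : Matrix.diagonal d * Matrix.diagonal d = 1 := by
        rw [Matrix.diagonal_mul_diagonal, ← Matrix.diagonal_one]
        congr 1; funext i; exact hd2 i
      have hdetd : ∏ i, d i = -1 := by
        rw [hdd, Finset.prod_update_of_mem (Finset.mem_univ _)]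
        simp
      refine ⟨Matrix.diagonal d * P, ?_, ?_⟩
      · rw [Matrix.mem_specialOrthogonalGroup_iff, Matrix.mem_orthogonalGroup_iff',
          Matrix.det_mul, Matrix.det_diagonal, hd, hdetd, Matrix.transpose_mul,
          Matrix.diagonal_transpose]
        refine ⟨?_, by norm_num⟩
        rw [mul_assoc, ← mul_assoc (Matrix.diagonal d), hEE, one_mul, hPP]
      · have hc : Matrix.diagonal d * Matrix.diagonal lam * Matrix.diagonal d =
            Matrix.diagonal lam := by
          rw [Matrix.diagonal_mul_diagonal, Matrix.diagonal_mul_diagonal]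
          congr 1; funext i
          linear_combination lam i * hd2 i
        rw [Matrix.transpose_mul, Matrix.diagonal_transpose]
        calc S = Pᵀ * Matrix.diagonal lam * P := hSP
          _ = Pᵀ * (Matrix.diagonal d * Matrix.diagonal lam * Matrix.diagonal d) * P := by rw [hc]
          _ = _ := by simp only [mul_assoc]
  · rintro ⟨Q, hQ, rfl⟩
    rw [Matrix.mem_specialOrthogonalGroup_iff, Matrix.mem_orthogonalGroup_iff] at hQ
    refine ⟨?_, ?_⟩
    · simp [Matrix.IsSymm, Matrix.transpose_mul, mul_assoc]
    · rw [mul_assoc, Matrix.charpoly_mul_comm, mul_assoc, hQ.1, mul_one]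

theorem bfrMap_eq {lam : Fin n → ℝ} (hlam : Function.Injective lam)
    {S Q : Matrix (Fin n) (Fin n) ℝ} (h : IsSpectralDecomp lam S Q) :
    bfrMap lam S = Matrix.diag (Q * Matrix.diagonal lam * Qᵀ) := by
  have hex : ∃ Q, IsSpectralDecomp lam S Q := ⟨Q, h⟩
  rw [bfrMap, dif_pos hex]
  obtain ⟨hQ', hS'⟩ := hex.choose_spec
  obtain ⟨hQ, hS⟩ := h
  generalize hex.choose = P at hQ' hS' ⊢
  rw [Matrix.mem_specialOrthogonalGroup_iff, Matrix.mem_orthogonalGroup_iff] at hQ hQ'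
  have q1 := hQ.1
  have q2 := mul_eq_one_comm.1 hQ.1
  have p1 := hQ'.1
  have p2 := mul_eq_one_comm.1 hQ'.1
  set Λ := Matrix.diagonal lam with hΛ
  set M := P * Qᵀ with hM
  have hcomm : M * Λ = Λ * M := by
    calc M * Λ = P * (Qᵀ * Λ * Q) * Qᵀ := by
          simp only [hM, mul_assoc, q1, mul_one]
      _ = P * (Pᵀ * Λ * P) * Qᵀ := by rw [← hS, ← hS']
      _ = (P * Pᵀ) * Λ * (P * Qᵀ) := by simp only [mul_assoc]
      _ = Λ * M := by rw [p1, one_mul]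
  have hoff : ∀ i j, i ≠ j → M i j = 0 := fun i j hij => by
    have := congrFun (congrFun hcomm i) j
    rw [hΛ, Matrix.mul_diagonal, Matrix.diagonal_mul] at this
    have h0 : (lam i - lam j) * M i j = 0 := by linear_combination -this
    exact (mul_eq_zero.1 h0).resolve_left (sub_ne_zero.2 fun e => hij (hlam e))
  have hMd : M = Matrix.diagonal (fun i => M i i) := by
    ext i j
    by_cases hij : i = j
    · subst hij; simp
    · rw [Matrix.diagonal_apply_ne _ hij, hoff i j hij]
  have hMM : M * Mᵀ = 1 := by
    rw [hM, Matrix.transpose_mul, Matrix.transpose_transpose, mul_assoc, ← mul_assoc Qᵀ, q2,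
      one_mul, p1]
  have hsq : ∀ i, M i i * M i i = 1 := fun i => by
    rw [hMd, Matrix.diagonal_transpose, Matrix.diagonal_mul_diagonal] at hMM
    simpa using congrFun (congrFun hMM i) i
  have hP : P = M * Q := by rw [hM, mul_assoc, q2, mul_one]
  have key : P * Λ * Pᵀ = M * (Q * Λ * Qᵀ) * Mᵀ := by
    rw [hP, Matrix.transpose_mul]; simp only [mul_assoc]
  rw [key, hMd, Matrix.diagonal_transpose]
  funext i
  rw [Matrix.diag_apply, Matrix.diag_apply, Matrix.mul_diagonal, Matrix.diagonal_mul]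
  linear_combination (Q * Λ * Qᵀ) i i * hsq i

end BFR

end

/-! Write `S = Q₀ᵀ Λ Q₀`. If `R S R⁻¹ = Pᵀ S P`, then `P R` commutes with `S`, so `Q₀ P R Q₀ᵀ`
commutes with `Λ` and is diagonal, because the spectrum is simple. Up to signs it equals `exp(diag
t)`, so `Q₀ P` is the orthogonal QR factor of `exp(diag t) Q₀`. The slice is therefore the image of
a positive torus orbit of the flag of `Q₀` (`slice_eq_image`), and on it the BFR map becomes the
moment map `Q ↦ diag (Q Λ Qᵀ)`.

Write `lam` as a constant plus a positive combination of fundamental weights. By Cauchy–Binet the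
moment is then a combination of averages of indicator vectors, weighted by squared Plücker
coordinates, that is, minors on the first `k` columns (`sum_mul_moment`). Along the orbit these
squares are proportional to `w f * exp (2 ∑ t (f a))`, so the moment is the gradient of a convex
log-sum-exp function. Spectral completeness makes every weight of an injective `f` positive. Strict
convexity modulo constants gives local diffeomorphisms (`exists_local_inverse`). Minimizing the
potential minus a linear form reaches every relative interior point (`exists_extendedMoment_eq`),
with coercivity because all vertices of the permutohedron contribute to the potential.

A monotonicity argument gives injectivity on the whole closure (`moment_injOn_closure`). Compactness
turns the continuous bijection into a homeomorphism. Smoothness of the BFR map comes from a Lagrange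
interpolation formula which is polynomial in `S`.

For a Jacobi matrix the Krylov vectors of the first basis vector show that the eigenvector matrix
has, up to row scaling, the flag of the Vandermonde matrix of `lam`. Its minors are thus nonzero,
and all Jacobi matrices with this spectrum lie on one orbit. -/

namespace BFR

/-! ### Cauchy–Binet and Plücker coordinates of flags. -/

section Minors

/-- The Cauchy–Binet formula, summed over all maps `f : κ → m` instead of over subsets of `m`. -/
theorem factorial_mul_det_transpose_mul {m κ : Type*} [Fintype m] [DecidableEq m] [Fintype κ]
    [DecidableEq κ] (A B : Matrix m κ ℝ) :
    ((Fintype.card κ).factorial : ℝ) * (Aᵀ * B).det =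
      ∑ f : κ → m, (A.submatrix f id).det * (B.submatrix f id).det := by
  have h1 : (Aᵀ * B).det = ∑ f : κ → m, (∏ a, A (f a) a) * (B.submatrix f id).det := by
    have hrow : (Aᵀ * B) = fun a => ∑ i, A i a • B i := by
      ext a b
      simp [Matrix.mul_apply, Finset.sum_apply]
    have := (Matrix.detRowAlternating (n := κ) (R := ℝ)).toMultilinearMap.map_sum
      (fun a (i : m) => A i a • B i)
    rw [Matrix.det, hrow]
    refine this.trans (Finset.sum_congr rfl fun f _ => ?_)
    exact (Matrix.detRowAlternating (n := κ) (R := ℝ)).toMultilinearMap.map_smul_univ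
      (fun a => A (f a) a) (fun a => B (f a))
  -- Relabelling `f` by `σ` costs the sign of `σ` in the minor of `B`. Summing over all `σ` then
  -- assembles the minor of `A`; this is the source of the factorial.
  have h2 : ∀ σ : Equiv.Perm κ, (Aᵀ * B).det =
      ∑ f : κ → m, ((Equiv.Perm.sign σ : ℤ) : ℝ) * (∏ a, A (f (σ a)) a) *
        (B.submatrix f id).det := by
    intro σ
    rw [h1, ← (Equiv.arrowCongr σ (Equiv.refl m)).sum_comp fun f => ((Equiv.Perm.sign σ : ℤ) : ℝ) *
      (∏ a, A (f (σ a)) a) * (B.submatrix f id).det]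
    refine Finset.sum_congr rfl fun f _ => ?_
    have e1 : ∀ a, (Equiv.arrowCongr σ (Equiv.refl m)) f (σ a) = f a := fun a => by simp
    have e2 : B.submatrix f id =
        (B.submatrix ((Equiv.arrowCongr σ (Equiv.refl m)) f) id).submatrix σ id := by
      ext a b; simp
    rw [Finset.prod_congr rfl fun a _ => congrArg (fun i => A i a) (e1 a), e2, Matrix.det_permute]
    ring
  have h3 : ((Fintype.card κ).factorial : ℝ) * (Aᵀ * B).det =
      ∑ σ : Equiv.Perm κ, (Aᵀ * B).det := by
    rw [Finset.sum_const, Finset.card_univ, Fintype.card_perm, nsmul_eq_mul]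
  rw [h3, Finset.sum_congr rfl fun σ _ => h2 σ, Finset.sum_comm]
  refine Finset.sum_congr rfl fun f _ => ?_
  rw [← Finset.sum_mul, Matrix.det_apply' (A.submatrix f id)]
  rfl

variable {n k : ℕ}

/-- The minor formed by the rows `f` and the first `k` columns. -/
noncomputable def minor (A : Matrix (Fin n) (Fin n) ℝ) (hk : k ≤ n) (f : Fin k → Fin n) : ℝ :=
  (A.submatrix f (Fin.castLE hk)).det

theorem minor_eq_zero (A : Matrix (Fin n) (Fin n) ℝ) (hk : k ≤ n) {f : Fin k → Fin n}
    (hf : ¬ Function.Injective f) : minor A hk f = 0 := by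
  simp only [Function.Injective, not_forall] at hf
  obtain ⟨a, b, hab, hne⟩ := hf
  exact Matrix.det_zero_of_row_eq hne (by ext c; simp [hab])

theorem minor_diagonal_mul (d : Fin n → ℝ) (A : Matrix (Fin n) (Fin n) ℝ) (hk : k ≤ n)
    (f : Fin k → Fin n) :
    minor (Matrix.diagonal d * A) hk f = (∏ a, d (f a)) * minor A hk f := by
  have : (Matrix.diagonal d * A).submatrix f (Fin.castLE hk) =
      Matrix.diagonal (fun a => d (f a)) * A.submatrix f (Fin.castLE hk) := by
    ext a b; simp [Matrix.diagonal_mul]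
  rw [minor, this, Matrix.det_mul, Matrix.det_diagonal, minor]

theorem sum_eq_sum_castLE (hk : k ≤ n) {g : Fin n → ℝ} (hg : ∀ i : Fin n, k ≤ i → g i = 0) :
    ∑ i, g i = ∑ a : Fin k, g (Fin.castLE hk a) := by
  have hinj : Function.Injective (Fin.castLE hk) := Fin.castLE_injective hk
  rw [← Finset.sum_image (s := Finset.univ) (g := Fin.castLE hk) (f := g)
    (fun a _ b _ h => hinj h)]
  refine (Finset.sum_subset (Finset.subset_univ _) fun i _ hi => hg i ?_).symm
  by_contra hlt
  push Not at hlt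
  exact hi (Finset.mem_image.2 ⟨⟨i, hlt⟩, Finset.mem_univ _, rfl⟩)

/-- Only the leading block of `R` acts on the first `k` columns. Hence these minors are coordinates
of the flag, defined up to one scalar for each `k`. -/
theorem minor_mul_upper (A : Matrix (Fin n) (Fin n) ℝ) {R : Matrix (Fin n) (Fin n) ℝ}
    (hR : ∀ i j, j < i → R i j = 0) (hk : k ≤ n) (f : Fin k → Fin n) :
    minor (A * R) hk f =
      minor A hk f * ∏ a : Fin k, R (Fin.castLE hk a) (Fin.castLE hk a) := by
  have h1 : (A * R).submatrix f (Fin.castLE hk) = A.submatrix f (Fin.castLE hk) *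
      R.submatrix (Fin.castLE hk) (Fin.castLE hk) := by
    ext a b
    simp only [Matrix.submatrix_apply, Matrix.mul_apply]
    refine sum_eq_sum_castLE hk (g := fun i => A (f a) i * R i (Fin.castLE hk b)) fun i hi => ?_
    rw [hR _ _ (lt_of_lt_of_le b.2 hi : (Fin.castLE hk b : Fin n).1 < i.1), mul_zero]
  have h2 : (R.submatrix (Fin.castLE hk) (Fin.castLE hk)).det =
      ∏ a : Fin k, R (Fin.castLE hk a) (Fin.castLE hk a) :=
    Matrix.det_of_isUpperTriangular fun i j hij => hR _ _ hij
  rw [minor, h1, Matrix.det_mul, h2, minor]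

theorem minor_comp_perm (A : Matrix (Fin n) (Fin n) ℝ) (hk : k ≤ n) (f : Fin k → Fin n)
    (σ : Equiv.Perm (Fin k)) :
    minor A hk (f ∘ σ) = ((Equiv.Perm.sign σ : ℤ) : ℝ) * minor A hk f := by
  rw [minor, minor, ← Matrix.det_permute]; rfl

theorem continuous_minor (hk : k ≤ n) (f : Fin k → Fin n) :
    Continuous fun A : Matrix (Fin n) (Fin n) ℝ => minor A hk f :=
  (continuous_id.matrix_submatrix f (Fin.castLE hk)).matrix_det

theorem minor_ne_zero_of_rows {A : Matrix (Fin n) (Fin n) ℝ} (hk : k ≤ n)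
    (h : ∀ rows : Fin k ↪o Fin n, (A.submatrix rows (Fin.castLE hk)).det ≠ 0)
    {f : Fin k → Fin n} (hf : Function.Injective f) : minor A hk f ≠ 0 := by
  have hm : StrictMono (f ∘ Tuple.sort f) :=
    (Tuple.monotone_sort f).strictMono_of_injective (hf.comp (Equiv.injective _))
  have := h (OrderEmbedding.ofStrictMono _ hm)
  have h2 : minor A hk (f ∘ Tuple.sort f) ≠ 0 := this
  rw [minor_comp_perm] at h2
  exact right_ne_zero_of_mul h2

theorem sum_minor_mul (A B : Matrix (Fin n) (Fin n) ℝ) (hk : k ≤ n) :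
    ∑ f : Fin k → Fin n, minor A hk f * minor B hk f =
      (k.factorial : ℝ) * ((Aᵀ * B).submatrix (Fin.castLE hk) (Fin.castLE hk)).det := by
  have := factorial_mul_det_transpose_mul (A.submatrix id (Fin.castLE hk))
    (B.submatrix id (Fin.castLE hk))
  rw [Fintype.card_fin] at this
  exact this.symm

/-- After division by `k!`, the squared minors form a probability distribution on maps `f`. -/
theorem sum_minor_sq {Q : Matrix (Fin n) (Fin n) ℝ} (hQ : Qᵀ * Q = 1) (hk : k ≤ n) :
    ∑ f : Fin k → Fin n, minor Q hk f ^ 2 = (k.factorial : ℝ) := by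
  simp only [sq, sum_minor_mul, hQ]
  rw [Matrix.submatrix_one _ (Fin.castLE_injective hk), Matrix.det_one, mul_one]

theorem sum_minor_sq_mul_indicator {Q : Matrix (Fin n) (Fin n) ℝ} (hQ : Qᵀ * Q = 1) (hk : k ≤ n)
    (i : Fin n) :
    ∑ f : Fin k → Fin n, minor Q hk f ^ 2 * ∑ a, (if f a = i then (1 : ℝ) else 0) =
      (k.factorial : ℝ) * ∑ a : Fin k, Q i (Fin.castLE hk a) ^ 2 := by
  -- For injective `f` the product of `d` along `f` is one plus the indicator of `i` in the range.
  -- Cauchy–Binet for `Q` and `diag d * Q` then produces the determinant of a rank-one perturbation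
  -- of the identity.
  set d : Fin n → ℝ := fun j => 1 + if j = i then (1 : ℝ) else 0 with hd
  have key : ∀ f : Fin k → Fin n, minor Q hk f ^ 2 * ∑ a, (if f a = i then (1 : ℝ) else 0) =
      minor Q hk f * minor (Matrix.diagonal d * Q) hk f - minor Q hk f ^ 2 := by
    intro f
    by_cases hf : Function.Injective f
    · have : ∏ a, d (f a) = 1 + ∑ a, (if f a = i then (1 : ℝ) else 0) := by
        by_cases hi : ∃ a, f a = i
        · obtain ⟨a, ha⟩ := hi
          have hb : ∀ b, f b = i ↔ b = a := fun b =>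
            ⟨fun h => hf (h.trans ha.symm), fun h => h ▸ ha⟩
          simp only [hd, hb]
          rw [Finset.prod_eq_single a (by intro b _ hb; simp [hb]) (by simp)]
          simp
        · push Not at hi
          simp [hd, hi]
      rw [minor_diagonal_mul, this]
      ring
    · simp [minor_eq_zero Q hk hf]
  rw [Finset.sum_congr rfl fun f _ => key f, Finset.sum_sub_distrib, sum_minor_sq hQ, sum_minor_mul]
  have h1 : (Qᵀ * (Matrix.diagonal d * Q)).submatrix (Fin.castLE hk) (Fin.castLE hk) =
      1 + Matrix.replicateCol Unit (fun a : Fin k => Q i (Fin.castLE hk a)) *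
        Matrix.replicateRow Unit (fun a : Fin k => Q i (Fin.castLE hk a)) := by
    have : Matrix.diagonal d = 1 + Matrix.diagonal (fun j => if j = i then (1 : ℝ) else 0) := by
      rw [← Matrix.diagonal_one, Matrix.diagonal_add]
    rw [this, add_mul, one_mul, mul_add, hQ]
    ext a b
    simp [Matrix.mul_apply, Matrix.one_apply, Matrix.diagonal_apply]
  rw [h1, Matrix.det_one_add_replicateCol_mul_replicateRow]
  simp only [dotProduct, ← sq]
  ring

theorem sum_minor_sq_mul_sum {Q : Matrix (Fin n) (Fin n) ℝ} (hQ : Qᵀ * Q = 1) (hk : k ≤ n)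
    (t : Fin n → ℝ) :
    ∑ f : Fin k → Fin n, minor Q hk f ^ 2 * ∑ a, t (f a) =
      (k.factorial : ℝ) * ∑ i, t i * ∑ a : Fin k, Q i (Fin.castLE hk a) ^ 2 := by
  have h : ∀ f : Fin k → Fin n, ∑ a, t (f a) =
      ∑ i, t i * ∑ a, (if f a = i then (1 : ℝ) else 0) := by
    intro f
    simp only [Finset.mul_sum]
    rw [Finset.sum_comm]
    simp
  simp only [h, Finset.mul_sum (s := Finset.univ (α := Fin n))]
  rw [Finset.sum_comm]
  refine Finset.sum_congr rfl fun i _ => ?_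
  rw [mul_left_comm, ← sum_minor_sq_mul_indicator hQ hk i, Finset.mul_sum]
  exact Finset.sum_congr rfl fun f _ => by ring

/-- An orthogonal matrix is determined by its minors on the first columns. -/
theorem eq_of_minor_eq {Q P : Matrix (Fin n) (Fin n) ℝ} (hQ : Qᵀ * Q = 1) (hP : Pᵀ * P = 1)
    (h : ∀ (j : Fin n) (f : Fin (j + 1) → Fin n),
      minor Q (Nat.succ_le_of_lt j.2) f = minor P (Nat.succ_le_of_lt j.2) f) : Q = P := by
  have hQe : ∀ a b, ∑ i, Q i a * Q i b = if a = b then 1 else 0 := fun a b => by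
    have := congrFun (congrFun hQ a) b
    simpa [Matrix.mul_apply, Matrix.one_apply] using this
  have hPe : ∀ a b, ∑ i, P i a * P i b = if a = b then 1 else 0 := fun a b => by
    have := congrFun (congrFun hP a) b
    simpa [Matrix.mul_apply, Matrix.one_apply] using this
  have main : ∀ m : ℕ, ∀ j : Fin n, j.1 = m → ∀ i, Q i j = P i j := by
    intro m
    induction m using Nat.strong_induction_on with
    | _ m ih =>
      rintro j rfl
      have hk := Nat.succ_le_of_lt j.2
      have hs := sum_minor_mul Q P hk
      have hs' := sum_minor_sq hQ hk
      simp only [sq] at hs'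
      rw [← Finset.sum_congr rfl fun f _ => by rw [← h j f], hs'] at hs
      -- By induction the earlier columns agree, so this leading block is diagonal with ones up to
      -- its last entry. Determinant one makes that entry, the inner product of the two `j`-th
      -- columns, equal to one, and unit vectors with inner product one coincide.
      have hdet : ((Qᵀ * P).submatrix (Fin.castLE hk) (Fin.castLE hk)).det = 1 := by
        have : ((j.1 + 1).factorial : ℝ) ≠ 0 := by positivity
        exact mul_left_cancel₀ this (by rw [← hs, mul_one])
      have hdiag : (Qᵀ * P).submatrix (Fin.castLE hk) (Fin.castLE hk) =
          Matrix.diagonal fun a => ∑ i, Q i (Fin.castLE hk a) * P i (Fin.castLE hk a) := by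
        ext a b
        simp only [Matrix.submatrix_apply, Matrix.mul_apply, Matrix.transpose_apply,
          Matrix.diagonal_apply]
        split_ifs with hab
        · rw [hab]
        · have hab' : Fin.castLE hk a ≠ Fin.castLE hk b := fun e => hab (Fin.castLE_injective hk e)
          by_cases ha : a.1 < j.1
          · rw [Finset.sum_congr rfl fun i _ => by rw [ih a.1 ha (Fin.castLE hk a) rfl i], hPe,
              if_neg hab']
          · have hb : b.1 < j.1 := by
              have := a.2; have := b.2
              have : a.1 ≠ b.1 := fun e => hab (Fin.ext e)
              omega
            rw [Finset.sum_congr rfl fun i _ => by rw [← ih b.1 hb (Fin.castLE hk b) rfl i], hQe,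
              if_neg hab']
      rw [hdiag, Matrix.det_diagonal, Finset.prod_eq_single (Fin.last j.1)] at hdet
      · have hl : Fin.castLE hk (Fin.last j.1) = j := rfl
        rw [hl] at hdet
        have h0 : ∑ i, (Q i j - P i j) ^ 2 = 0 := by
          have e1 := hQe j j
          have e2 := hPe j j
          rw [if_pos rfl] at e1 e2
          calc ∑ i, (Q i j - P i j) ^ 2
              = ∑ i, Q i j * Q i j + ∑ i, P i j * P i j - 2 * ∑ i, Q i j * P i j := by
                rw [Finset.mul_sum, ← Finset.sum_add_distrib, ← Finset.sum_sub_distrib]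
                exact Finset.sum_congr rfl fun i _ => by ring
            _ = 0 := by rw [e1, e2, hdet]; norm_num
        intro i
        have := (Finset.sum_eq_zero_iff_of_nonneg fun i _ => sq_nonneg _).1 h0 i (Finset.mem_univ i)
        exact sub_eq_zero.1 (pow_eq_zero_iff two_ne_zero |>.1 this)
      · intro a _ ha
        have ha' : a.1 < j.1 := by
          have := a.2
          have : a.1 ≠ j.1 := fun e => ha (Fin.ext e)
          omega
        rw [Finset.sum_congr rfl fun i _ => by rw [ih a.1 ha' (Fin.castLE hk a) rfl i], hPe,
          if_pos rfl]
      · simp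
  ext i j
  exact main j.1 j rfl i

end Minors

/-! ### The group of upper triangular matrices with positive diagonal. -/

section UpperTriangular

variable {n : ℕ} {R R' : Matrix (Fin n) (Fin n) ℝ}

theorem det_pos_of_mem_upPos (hR : R ∈ upPos n) : 0 < R.det := by
  rw [Matrix.det_of_isUpperTriangular fun i j hij => hR.1 i j hij]
  exact Finset.prod_pos fun i _ => hR.2 i

theorem isUnit_det_of_mem_upPos (hR : R ∈ upPos n) : IsUnit R.det :=
  (det_pos_of_mem_upPos hR).ne'.isUnit

theorem mul_mem_upPos (hR : R ∈ upPos n) (hR' : R' ∈ upPos n) : R * R' ∈ upPos n := by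
  refine ⟨fun i j hij => ?_, fun i => ?_⟩
  · rw [Matrix.mul_apply]
    refine Finset.sum_eq_zero fun a _ => ?_
    rcases lt_or_ge a i with h | h
    · rw [hR.1 _ _ h, zero_mul]
    · rw [hR'.1 _ _ (hij.trans_le h), mul_zero]
  · rw [Matrix.mul_apply, Finset.sum_eq_single i]
    · exact mul_pos (hR.2 i) (hR'.2 i)
    · intro a _ ha
      rcases lt_or_gt_of_ne ha with h | h
      · rw [hR.1 _ _ h, zero_mul]
      · rw [hR'.1 _ _ h, mul_zero]
    · simp

theorem inv_mem_upPos (hR : R ∈ upPos n) : R⁻¹ ∈ upPos n := by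
  have hu := isUnit_det_of_mem_upPos hR
  have := R.invertibleOfIsUnitDet hu
  have hB : R⁻¹.BlockTriangular id :=
    Matrix.blockTriangular_inv_of_blockTriangular fun i j hij => hR.1 i j hij
  refine ⟨fun i j hij => hB hij, fun i => ?_⟩
  have h1 := congrFun (congrFun (Matrix.mul_nonsing_inv R hu) i) i
  rw [Matrix.mul_apply, Finset.sum_eq_single i, Matrix.one_apply_eq] at h1
  · exact pos_of_mul_pos_right (h1 ▸ one_pos) (hR.2 i).le
  · intro a _ ha
    rcases lt_or_gt_of_ne ha with h | h
    · rw [hR.1 _ _ h, zero_mul]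
    · rw [hB h, mul_zero]
  · simp

end UpperTriangular

/-! ### Slices as positive torus orbits of flags. -/

section Orbit

variable {n : ℕ}

/-- `Q` is the orthogonal factor in the `QR` decomposition of `exp(diag t) Q₀`. -/
def IsOrbitPoint (Q₀ : Matrix (Fin n) (Fin n) ℝ) (t : Fin n → ℝ)
    (Q : Matrix (Fin n) (Fin n) ℝ) : Prop :=
  Qᵀ * Q = 1 ∧ ∃ R ∈ upPos n, Q * R = Matrix.diagonal (fun i => Real.exp (t i)) * Q₀

/-- The orthogonal matrices representing the positive torus orbit of the flag of `Q₀`. -/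
def orbit (Q₀ : Matrix (Fin n) (Fin n) ℝ) : Set (Matrix (Fin n) (Fin n) ℝ) :=
  {Q | ∃ t, IsOrbitPoint Q₀ t Q}

variable {Q₀ Q P S T : Matrix (Fin n) (Fin n) ℝ} {lam t : Fin n → ℝ}

theorem mem_SO_iff :
    Q ∈ Matrix.specialOrthogonalGroup (Fin n) ℝ ↔ Qᵀ * Q = 1 ∧ Q.det = 1 := by
  rw [Matrix.mem_specialOrthogonalGroup_iff, Matrix.mem_orthogonalGroup_iff']

/-- The exponential diagonal, `Q₀` and `R` all have positive determinant, which excludes the value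
`-1` for the orthogonal factor. -/
theorem IsOrbitPoint.det_eq_one (h : IsOrbitPoint Q₀ t Q) (h₀ : 0 < Q₀.det) : Q.det = 1 := by
  obtain ⟨hQ, R, hR, he⟩ := h
  have h1 := congrArg Matrix.det he
  rw [Matrix.det_mul, Matrix.det_mul, Matrix.det_diagonal] at h1
  have hp : 0 < Q.det * R.det := by
    rw [h1]; exact mul_pos (Finset.prod_pos fun i _ => Real.exp_pos _) h₀
  have hq : 0 < Q.det := pos_of_mul_pos_left hp (det_pos_of_mem_upPos hR).le
  have h2 := congrArg Matrix.det hQ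
  rw [Matrix.det_mul, Matrix.det_transpose, Matrix.det_one] at h2
  nlinarith

/-- Points of the torus orbit give points of the slice. -/
theorem mem_slice_of_mul_eq (h₀ : Q₀ ∈ Matrix.specialOrthogonalGroup (Fin n) ℝ)
    (hQ : IsOrbitPoint Q₀ t Q) :
    Qᵀ * Matrix.diagonal lam * Q ∈ slice (Q₀ᵀ * Matrix.diagonal lam * Q₀) := by
  obtain ⟨o1, o2⟩ := mem_SO_iff.1 h₀
  have o3 := mul_eq_one_comm.1 o1
  have hdet := hQ.det_eq_one (o2 ▸ one_pos)
  obtain ⟨q1, R, hR, he⟩ := hQ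
  have q3 := mul_eq_one_comm.1 q1
  refine ⟨⟨Q₀ᵀ * Q, mem_SO_iff.2 ⟨?_, ?_⟩, ?_⟩, R, hR, ?_⟩
  · rw [Matrix.transpose_mul, Matrix.transpose_transpose, Matrix.mul_assoc, ← Matrix.mul_assoc Q₀,
      o3, Matrix.one_mul, q1]
  · rw [Matrix.det_mul, Matrix.det_transpose, o2, hdet, one_mul]
  · rw [Matrix.transpose_mul, Matrix.transpose_transpose]
    calc Qᵀ * Matrix.diagonal lam * Q
        = Qᵀ * (Q₀ * Q₀ᵀ) * Matrix.diagonal lam * (Q₀ * Q₀ᵀ) * Q := by simp [o3]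
      _ = _ := by simp only [Matrix.mul_assoc]
  · have hu := isUnit_det_of_mem_upPos hR
    have hD : Matrix.diagonal (fun i => Real.exp (t i)) * Matrix.diagonal lam =
        Matrix.diagonal lam * Matrix.diagonal (fun i => Real.exp (t i)) := by
      rw [Matrix.diagonal_mul_diagonal, Matrix.diagonal_mul_diagonal]
      congr 1; funext i; ring
    have h1 : Qᵀ * Matrix.diagonal (fun i => Real.exp (t i)) = R * Q₀ᵀ := by
      calc Qᵀ * Matrix.diagonal (fun i => Real.exp (t i))
          = Qᵀ * (Matrix.diagonal (fun i => Real.exp (t i)) * Q₀) * Q₀ᵀ := by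
            simp only [Matrix.mul_assoc, o3, Matrix.mul_one]
        _ = (Qᵀ * Q) * R * Q₀ᵀ := by rw [← he]; simp only [Matrix.mul_assoc]
        _ = R * Q₀ᵀ := by rw [q1, Matrix.one_mul]
    have h2 : Qᵀ * Matrix.diagonal lam * Q * R = R * (Q₀ᵀ * Matrix.diagonal lam * Q₀) := by
      calc Qᵀ * Matrix.diagonal lam * Q * R = Qᵀ * Matrix.diagonal lam * (Q * R) := by
            simp only [Matrix.mul_assoc]
        _ = Qᵀ * (Matrix.diagonal (fun i => Real.exp (t i)) * Matrix.diagonal lam) * Q₀ := by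
            rw [he, hD]; simp only [Matrix.mul_assoc]
        _ = R * Q₀ᵀ * Matrix.diagonal lam * Q₀ := by rw [← h1]; simp only [Matrix.mul_assoc]
        _ = _ := by simp only [Matrix.mul_assoc]
    rw [← h2, Matrix.mul_assoc _ R, Matrix.mul_nonsing_inv _ hu, Matrix.mul_one]

/-- Multiplying the rows by signs makes a diagonal factor positive. -/
theorem exists_isOrbitPoint_of_mul_eq (hP : Pᵀ * P = 1) {R : Matrix (Fin n) (Fin n) ℝ}
    (hR : R ∈ upPos n) {d : Fin n → ℝ} (hd : ∀ i, d i ≠ 0) (h : P * R = Matrix.diagonal d * Q₀) :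
    ∃ t Q, IsOrbitPoint Q₀ t Q ∧
      Qᵀ * Matrix.diagonal lam * Q = Pᵀ * Matrix.diagonal lam * P := by
  -- The sign matrix squares to one and commutes with `Λ`, so passing from `P` to `E * P` leaves the
  -- conjugate of `Λ` unchanged while `d` becomes `|d|`, whose logarithm is the torus parameter.
  set E := Matrix.diagonal fun i => (SignType.sign (d i) : ℝ) with hE
  have hs : ∀ i, (SignType.sign (d i) : ℝ) * (SignType.sign (d i) : ℝ) = 1 := fun i => by
    rcases lt_or_gt_of_ne (hd i) with h | h <;> simp [h]
  have hET : Eᵀ = E := Matrix.diagonal_transpose _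
  refine ⟨fun i => Real.log |d i|, E * P, ⟨?_, R, hR, ?_⟩, ?_⟩
  · rw [Matrix.transpose_mul, hET, Matrix.mul_assoc, ← Matrix.mul_assoc E, hE,
      Matrix.diagonal_mul_diagonal]
    simp [hs, hP]
  · rw [Matrix.mul_assoc, h, ← Matrix.mul_assoc, hE, Matrix.diagonal_mul_diagonal]
    congr 2; funext i
    rw [Real.exp_log (abs_pos.2 (hd i)), sign_mul_self]
  · have hc : E * Matrix.diagonal lam * E = Matrix.diagonal lam := by
      rw [hE, Matrix.diagonal_mul_diagonal, Matrix.diagonal_mul_diagonal]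
      congr 1; funext i
      linear_combination lam i * hs i
    rw [Matrix.transpose_mul, hET]
    calc Pᵀ * E * Matrix.diagonal lam * (E * P) = Pᵀ * (E * Matrix.diagonal lam * E) * P := by
          simp only [Matrix.mul_assoc]
      _ = _ := by rw [hc]

theorem slice_eq_image (hlam : Function.Injective lam)
    (h₀ : Q₀ ∈ Matrix.specialOrthogonalGroup (Fin n) ℝ) :
    slice (Q₀ᵀ * Matrix.diagonal lam * Q₀) =
      (fun Q => Qᵀ * Matrix.diagonal lam * Q) '' orbit Q₀ := by
  apply Set.Subset.antisymm
  · rintro T ⟨⟨P, hP, hT⟩, R, hR, hT'⟩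
    obtain ⟨o1, o2⟩ := mem_SO_iff.1 h₀
    have o3 := mul_eq_one_comm.1 o1
    obtain ⟨p1, p2⟩ := mem_SO_iff.1 hP
    have p3 := mul_eq_one_comm.1 p1
    have hu := isUnit_det_of_mem_upPos hR
    set S := Q₀ᵀ * Matrix.diagonal lam * Q₀ with hS
    -- Equality of the two conjugates of `S` is a commutation relation. Transported by `Q₀` it says
    -- that `B` commutes with `Λ`, and simplicity of the spectrum makes `B` diagonal.
    have hc : S * (P * R) = P * R * S := by
      calc S * (P * R) = (P * Pᵀ) * S * P * R := by rw [p3]; simp [Matrix.mul_assoc]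
        _ = P * (Pᵀ * S * P) * R := by simp only [Matrix.mul_assoc]
        _ = P * (R * S * R⁻¹) * R := by rw [← hT, hT']
        _ = P * R * S * (R⁻¹ * R) := by simp only [Matrix.mul_assoc]
        _ = P * R * S := by rw [Matrix.nonsing_inv_mul _ hu, Matrix.mul_one]
    set B := Q₀ * (P * R) * Q₀ᵀ with hB
    have hBc : Matrix.diagonal lam * B = B * Matrix.diagonal lam := by
      calc Matrix.diagonal lam * B = (Q₀ * Q₀ᵀ) * Matrix.diagonal lam * Q₀ * (P * R) * Q₀ᵀ := by
            rw [o3, hB]; simp [Matrix.mul_assoc]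
        _ = Q₀ * (S * (P * R)) * Q₀ᵀ := by rw [hS]; simp only [Matrix.mul_assoc]
        _ = Q₀ * (P * R) * Q₀ᵀ * Matrix.diagonal lam * (Q₀ * Q₀ᵀ) := by
            rw [hc, hS]; simp only [Matrix.mul_assoc]
        _ = _ := by rw [o3, Matrix.mul_one]
    have hBd : B = Matrix.diagonal fun i => B i i := by
      ext i j
      by_cases hij : i = j
      · subst hij; simp
      · rw [Matrix.diagonal_apply_ne _ hij]
        have := congrFun (congrFun hBc i) j
        rw [Matrix.mul_diagonal, Matrix.diagonal_mul] at this
        have h0 : (lam i - lam j) * B i j = 0 := by linear_combination this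
        exact (mul_eq_zero.1 h0).resolve_left (sub_ne_zero.2 fun e => hij (hlam e))
    have hBdet : B.det ≠ 0 := by
      rw [hB]
      simp only [Matrix.det_mul, Matrix.det_transpose, o2, p2, one_mul, mul_one]
      exact (det_pos_of_mem_upPos hR).ne'
    rw [hBd, Matrix.det_diagonal] at hBdet
    have hd := fun i => Finset.prod_ne_zero_iff.1 hBdet i (Finset.mem_univ i)
    have hm : Q₀ * P * R = Matrix.diagonal (fun i => B i i) * Q₀ := by
      rw [← hBd, hB, Matrix.mul_assoc _ Q₀ᵀ, o1, Matrix.mul_one, Matrix.mul_assoc]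
    have hO : (Q₀ * P)ᵀ * (Q₀ * P) = 1 := by
      rw [Matrix.transpose_mul, Matrix.mul_assoc, ← Matrix.mul_assoc Q₀ᵀ, o1, Matrix.one_mul, p1]
    obtain ⟨t, Q, hQ, he⟩ := exists_isOrbitPoint_of_mul_eq (lam := lam) hO hR hd hm
    refine ⟨Q, ⟨t, hQ⟩, ?_⟩
    change Qᵀ * Matrix.diagonal lam * Q = T
    rw [he, hT, hS, Matrix.transpose_mul]
    simp only [Matrix.mul_assoc]
  · rintro _ ⟨Q, ⟨t, hQ⟩, rfl⟩
    exact mem_slice_of_mul_eq h₀ hQ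

end Orbit

/-! ### The moment map and fundamental weights. -/

section Moment

variable {n : ℕ}

/-- The diagonal of `Q Λ Qᵀ`. -/
noncomputable def moment (lam : Fin n → ℝ) (Q : Matrix (Fin n) (Fin n) ℝ) : Fin n → ℝ :=
  fun i => ∑ a, lam a * Q i a ^ 2

theorem bfrMap_eq_moment {lam : Fin n → ℝ} (hlam : Function.Injective lam)
    {Q : Matrix (Fin n) (Fin n) ℝ} (hQ : Q ∈ Matrix.specialOrthogonalGroup (Fin n) ℝ) :
    bfrMap lam (Qᵀ * Matrix.diagonal lam * Q) = moment lam Q := by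
  rw [bfrMap_eq hlam ⟨hQ, rfl⟩]
  funext i
  rw [Matrix.diag_apply, Matrix.mul_apply, moment]
  refine Finset.sum_congr rfl fun a _ => ?_
  rw [Matrix.mul_diagonal, Matrix.transpose_apply]; ring

theorem sum_moment (lam : Fin n → ℝ) {Q : Matrix (Fin n) (Fin n) ℝ} (hQ : Qᵀ * Q = 1) :
    ∑ i, moment lam Q i = ∑ i, lam i := by
  simp only [moment]
  rw [Finset.sum_comm]
  refine Finset.sum_congr rfl fun a _ => ?_
  have := congrFun (congrFun hQ a) a
  rw [Matrix.mul_apply, Matrix.one_apply_eq] at this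
  rw [← Finset.mul_sum]
  simp only [sq]
  exact (congrArg (lam a * ·) this).trans (mul_one _)

/-- A strictly decreasing vector is a constant plus a positive combination of the fundamental
weights. -/
theorem exists_fundamental_weights {lam : Fin n → ℝ} (hlam : StrictAnti lam) :
    ∃ (C : ℝ) (c : Fin n → ℝ), (∀ j, 0 < c j) ∧
      ∀ a, lam a = C + ∑ j ∈ Finset.Ici a, c j := by
  induction n with
  | zero => exact ⟨0, fun _ => 1, fun _ => one_pos, fun a => a.elim0⟩
  | succ m ih =>
    obtain ⟨C, c, hc, h⟩ := ih (lam := fun i => lam i.succ)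
      (fun i j hij => hlam (Fin.succ_lt_succ_iff.2 hij))
    rcases m.eq_zero_or_pos with rfl | hm
    -- With a single entry only the sum of `C` and the weight is determined, so any positive weight
    -- serves.
    · refine ⟨lam 0 - 1, fun _ => 1, fun _ => one_pos, fun a => ?_⟩
      have h0 : a = 0 := Fin.ext (by omega)
      have h1 : Finset.Ici (0 : Fin (0 + 1)) = {0} := by decide
      rw [h0, h1]
      simp
    -- The new weight is the first gap, positive because `lam` decreases.
    · refine ⟨C, Fin.cons (lam 0 - lam (Fin.succ ⟨0, hm⟩)) c, ?_, ?_⟩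
      · refine Fin.cases ?_ fun j => ?_
        · exact sub_pos.2 (hlam (Fin.succ_pos _))
        · simpa using hc j
      · have hsucc : ∀ a : Fin m, ∑ j ∈ Finset.Ici a.succ,
            (Fin.cons (lam 0 - lam (Fin.succ ⟨0, hm⟩)) c : Fin (m + 1) → ℝ) j =
            ∑ j ∈ Finset.Ici a, c j := by
          intro a
          have : Finset.Ici a.succ = (Finset.Ici a).map (Fin.succEmb m) := by
            ext x
            refine Fin.cases ?_ (fun y => ?_) x
            · simp
            · simp
          rw [this, Finset.sum_map]
          simp
        refine Fin.cases ?_ fun a => ?_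
        · have h0 : Finset.Ici (0 : Fin (m + 1)) = insert 0 (Finset.Ici (Fin.succ ⟨0, hm⟩)) := by
            ext x
            refine Fin.cases ?_ (fun y => ?_) x
            · simp
            · simp [Fin.le_def]
          rw [h0, Finset.sum_insert (by simp), hsucc, Fin.cons_zero]
          have := h ⟨0, hm⟩
          linarith
        · rw [hsucc]; exact h a

/-- Summation by parts for `lam = C + ∑ c`. -/
theorem sum_mul_eq_of_weights {lam c : Fin n → ℝ} {C : ℝ}
    (h : ∀ a, lam a = C + ∑ j ∈ Finset.Ici a, c j) (y : Fin n → ℝ) :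
    ∑ a, lam a * y a = C * ∑ a, y a +
      ∑ j : Fin n, c j * ∑ a : Fin (j + 1), y (Fin.castLE (Nat.succ_le_of_lt j.2) a) := by
  have h1 : ∀ j : Fin n, ∑ a : Fin (j + 1), y (Fin.castLE (Nat.succ_le_of_lt j.2) a) =
      ∑ a, if a ≤ j then y a else 0 := by
    intro j
    rw [sum_eq_sum_castLE (Nat.succ_le_of_lt j.2)]
    · refine Finset.sum_congr rfl fun a _ => ?_
      rw [if_pos]
      exact Nat.lt_succ_iff.1 a.2
    · intro i hi
      rw [if_neg]
      exact not_le.2 (Nat.lt_of_succ_le hi)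
  simp only [h1, h, add_mul, Finset.sum_add_distrib, Finset.mul_sum]
  congr 1
  rw [Finset.sum_comm]
  refine Finset.sum_congr rfl fun a _ => ?_
  rw [Finset.sum_mul, ← Finset.sum_filter_add_sum_filter_not Finset.univ (fun j => a ≤ j)]
  rw [Finset.sum_eq_zero (s := Finset.univ.filter fun j => ¬ a ≤ j), add_zero]
  · refine Finset.sum_congr (by ext; simp) fun j hj => ?_
    rw [if_pos (Finset.mem_filter.1 hj).2]
  · intro j hj
    rw [if_neg (Finset.mem_filter.1 hj).2, mul_zero]

/-- The moment map in terms of the squared Plücker coordinates. -/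
theorem sum_mul_moment {lam c : Fin n → ℝ} {C : ℝ}
    (h : ∀ a, lam a = C + ∑ j ∈ Finset.Ici a, c j) {Q : Matrix (Fin n) (Fin n) ℝ}
    (hQ : Qᵀ * Q = 1) (t : Fin n → ℝ) :
    ∑ i, t i * moment lam Q i = C * ∑ i, t i + ∑ j : Fin n, c j *
      ((∑ f : Fin (j + 1) → Fin n, minor Q (Nat.succ_le_of_lt j.2) f ^ 2 * ∑ a, t (f a)) /
        ((j + 1 : ℕ).factorial : ℝ)) := by
  have hrow : ∀ i, ∑ a, Q i a ^ 2 = 1 := fun i => by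
    have hQ' : Q * Qᵀ = 1 := mul_eq_one_comm.1 hQ
    have := congrFun (congrFun hQ' i) i
    rw [Matrix.mul_apply, Matrix.one_apply_eq] at this
    simpa [sq] using this
  have h1 : ∀ j : Fin n, (∑ f : Fin (j + 1) → Fin n,
      minor Q (Nat.succ_le_of_lt j.2) f ^ 2 * ∑ a, t (f a)) / ((j + 1 : ℕ).factorial : ℝ) =
      ∑ i, t i * ∑ a : Fin (j + 1), Q i (Fin.castLE (Nat.succ_le_of_lt j.2) a) ^ 2 := by
    intro j
    rw [sum_minor_sq_mul_sum hQ, mul_div_cancel_left₀]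
    positivity
  simp only [h1]
  have h2 : ∀ i, t i * moment lam Q i = C * t i + ∑ j : Fin n, c j *
      (t i * ∑ a : Fin (j + 1), Q i (Fin.castLE (Nat.succ_le_of_lt j.2) a) ^ 2) := by
    intro i
    rw [moment, sum_mul_eq_of_weights h, hrow, mul_one, mul_add, Finset.mul_sum]
    congr 1
    · ring
    · exact Finset.sum_congr rfl fun j _ => by ring
  rw [Finset.sum_congr rfl fun i _ => h2 i, Finset.sum_add_distrib, ← Finset.mul_sum,
    Finset.sum_comm]
  simp only [Finset.mul_sum]

end Moment

/-! ### Injectivity of the moment map on the orbit closure. -/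

section Injectivity

variable {n : ℕ} {Q₀ Q P : Matrix (Fin n) (Fin n) ℝ} {t : Fin n → ℝ}

/-- The torus acts on Plücker coordinates by exponentials, and the triangular factor contributes a
positive scalar `ρ` that does not depend on the rows. -/
theorem IsOrbitPoint.minor_mul_eq (h : IsOrbitPoint Q₀ t Q) {k : ℕ} (hk : k ≤ n) :
    ∃ ρ : ℝ, 0 < ρ ∧ ∀ f : Fin k → Fin n,
      minor Q hk f * ρ = Real.exp (∑ a, t (f a)) * minor Q₀ hk f := by
  obtain ⟨-, R, hR, he⟩ := h
  refine ⟨∏ a : Fin k, R (Fin.castLE hk a) (Fin.castLE hk a),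
    Finset.prod_pos fun a _ => hR.2 _, fun f => ?_⟩
  rw [← minor_mul_upper Q hR.1, he, minor_diagonal_mul, Real.exp_sum]

theorem IsOrbitPoint.log_minor_sq (h : IsOrbitPoint Q₀ t Q) {k : ℕ} (hk : k ≤ n) :
    ∃ κ : ℝ, ∀ f : Fin k → Fin n, minor Q₀ hk f ≠ 0 → 0 < minor Q hk f ^ 2 ∧
      Real.log (minor Q hk f ^ 2) = 2 * ∑ a, t (f a) + Real.log (minor Q₀ hk f ^ 2) - κ := by
  obtain ⟨ρ, hρ, hf⟩ := h.minor_mul_eq hk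
  refine ⟨2 * Real.log ρ, fun f h0 => ?_⟩
  have hne : minor Q hk f ≠ 0 := by
    intro e
    have := hf f
    rw [e, zero_mul] at this
    exact mul_ne_zero (Real.exp_pos _).ne' h0 this.symm
  refine ⟨by positivity, ?_⟩
  have := congrArg Real.log (hf f)
  rw [Real.log_mul hne hρ.ne', Real.log_mul (Real.exp_pos _).ne' h0, Real.log_exp] at this
  rw [Real.log_pow, Real.log_pow]
  push_cast
  linarith

theorem isClosed_transpose_mul_self :
    IsClosed {Q : Matrix (Fin n) (Fin n) ℝ | Qᵀ * Q = 1} :=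
  isClosed_eq (continuous_id.matrix_transpose.matrix_mul continuous_id) continuous_const

theorem transpose_mul_self_of_mem_closure (h : Q ∈ closure (orbit Q₀)) : Qᵀ * Q = 1 := by
  refine closure_minimal ?_ isClosed_transpose_mul_self h
  rintro Q ⟨t, h⟩
  exact h.1

/-- Signs of Plücker coordinates never flip along the orbit. Hence, on the closure, a minor is
determined by its square wherever the minor of `Q₀` is nonzero. -/
theorem minor_mul_nonneg_of_mem_closure (h : Q ∈ closure (orbit Q₀)) {k : ℕ} (hk : k ≤ n)
    (f : Fin k → Fin n) : 0 ≤ minor Q hk f * minor Q₀ hk f := by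
  refine closure_minimal (t := {Q | 0 ≤ minor Q hk f * minor Q₀ hk f}) ?_
    (isClosed_le continuous_const ((continuous_minor hk f).mul continuous_const)) h
  rintro Q ⟨t, h⟩
  obtain ⟨ρ, hρ, hf⟩ := h.minor_mul_eq hk
  refine nonneg_of_mul_nonneg_left (b := ρ) ?_ hρ
  rw [mul_right_comm, hf]
  have := Real.exp_pos (∑ a, t (f a))
  nlinarith [mul_self_nonneg (minor Q₀ hk f)]

/-- Monotonicity of the gradient of a convex function, extended to the boundary. Logarithms of
minors may be undefined at `Q` and `P`, so they are taken at nearby orbit points `Q₁`, `P₁`. The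
differences of logarithms are, up to constants, linear in the torus parameters, so pairing them with
the differences of squared minors of `Q` and `P` gives a multiple of the pairing with the difference
of moments, which is zero. -/
theorem minor_sq_eq_of_moment_eq {lam : Fin n → ℝ} (hlam : StrictAnti lam)
    (h₀ : ∀ (j : Fin n) (f : Fin (j + 1) → Fin n), Function.Injective f →
      minor Q₀ (Nat.succ_le_of_lt j.2) f ≠ 0)
    (hQ : Q ∈ closure (orbit Q₀)) (hP : P ∈ closure (orbit Q₀))
    (hm : moment lam Q = moment lam P) (j : Fin n) (f : Fin (j + 1) → Fin n) :
    minor Q (Nat.succ_le_of_lt j.2) f ^ 2 = minor P (Nat.succ_le_of_lt j.2) f ^ 2 := by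
  by_contra hne
  obtain ⟨C, c, hc, hw⟩ := exists_fundamental_weights hlam
  have hpair : (Q, P) ∈ closure (orbit Q₀ ×ˢ orbit Q₀) := by
    rw [closure_prod_eq]; exact ⟨hQ, hP⟩
  set x : (j : Fin n) → (Fin (j + 1) → Fin n) → Matrix (Fin n) (Fin n) ℝ → ℝ :=
    fun j f A => minor A (Nat.succ_le_of_lt j.2) f ^ 2 with hx
  have hxc : ∀ j f, Continuous (x j f) := fun j f => (continuous_minor _ f).pow 2
  -- Strict inequalities between the squared minors of `Q` and `P` persist nearby. This is all that
  -- is needed to give every summand of the pairing the right sign.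
  have hev : ∀ᶠ z in nhds (Q, P), ∀ j f, (x j f Q < x j f P → x j f z.1 < x j f z.2) ∧
      (x j f P < x j f Q → x j f z.2 < x j f z.1) := by
    rw [Filter.eventually_all]; intro j
    rw [Filter.eventually_all]; intro f
    have c1 : Continuous fun z : Matrix (Fin n) (Fin n) ℝ × Matrix (Fin n) (Fin n) ℝ =>
      x j f z.1 := (hxc j f).comp continuous_fst
    have c2 : Continuous fun z : Matrix (Fin n) (Fin n) ℝ × Matrix (Fin n) (Fin n) ℝ =>
      x j f z.2 := (hxc j f).comp continuous_snd
    rw [Filter.eventually_and]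
    constructor
    · by_cases h : x j f Q < x j f P
      · filter_upwards [(isOpen_lt c1 c2).mem_nhds h] with z hz _ using hz
      · exact Filter.Eventually.of_forall fun z h' => absurd h' h
    · by_cases h : x j f P < x j f Q
      · filter_upwards [(isOpen_lt c2 c1).mem_nhds h] with z hz _ using hz
      · exact Filter.Eventually.of_forall fun z h' => absurd h' h
  obtain ⟨⟨Q₁, P₁⟩, ⟨⟨t, hQ₁⟩, ⟨s, hP₁⟩⟩, hz⟩ :=
    ((mem_closure_iff_frequently.1 hpair).and_eventually hev).exists
  simp only at hQ₁ hP₁ hz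
  have hQO := transpose_mul_self_of_mem_closure hQ
  have hPO := transpose_mul_self_of_mem_closure hP
  -- the monotone pairing vanishes, because the moments agree
  have hzero : ∑ j : Fin n, c j * ((∑ f : Fin (j + 1) → Fin n, (x j f Q - x j f P) *
      (Real.log (x j f Q₁) - Real.log (x j f P₁))) / ((j + 1 : ℕ).factorial : ℝ)) = 0 := by
    have e1 := sum_mul_moment hw hQO (fun i => t i - s i)
    have e2 := sum_mul_moment hw hPO (fun i => t i - s i)
    rw [hm, e2, add_right_inj] at e1
    have e3 : ∀ j : Fin n, ∑ f : Fin (j + 1) → Fin n, (x j f Q - x j f P) *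
        (Real.log (x j f Q₁) - Real.log (x j f P₁)) =
        2 * (∑ f : Fin (j + 1) → Fin n, x j f Q * ∑ a, (t (f a) - s (f a)) -
          ∑ f : Fin (j + 1) → Fin n, x j f P * ∑ a, (t (f a) - s (f a))) := by
      intro j
      obtain ⟨κ, hκ⟩ := hQ₁.log_minor_sq (Nat.succ_le_of_lt j.2)
      obtain ⟨κ', hκ'⟩ := hP₁.log_minor_sq (Nat.succ_le_of_lt j.2)
      have e4 : ∀ f : Fin (j + 1) → Fin n, (x j f Q - x j f P) *
          (Real.log (x j f Q₁) - Real.log (x j f P₁)) =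
          2 * (x j f Q * ∑ a, (t (f a) - s (f a)) - x j f P * ∑ a, (t (f a) - s (f a))) -
            (κ - κ') * (x j f Q - x j f P) := by
        intro f
        by_cases hf : Function.Injective f
        · rw [(hκ f (h₀ j f hf)).2, (hκ' f (h₀ j f hf)).2, Finset.sum_sub_distrib]
          ring
        · simp [hx, minor_eq_zero _ _ hf]
      -- The normalizing constants `κ`, `κ'` drop out because the squared minors of `Q` and of `P`
      -- have the same total.
      rw [Finset.sum_congr rfl fun f _ => e4 f, Finset.sum_sub_distrib, ← Finset.mul_sum,
        ← Finset.mul_sum, Finset.sum_sub_distrib, Finset.sum_sub_distrib,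
        sum_minor_sq hQO, sum_minor_sq hPO, sub_self, mul_zero, sub_zero]
    simp only [e3]
    have e5 : ∀ j : Fin n, c j * (2 * (∑ f : Fin (j + 1) → Fin n, x j f Q *
        ∑ a, (t (f a) - s (f a)) - ∑ f : Fin (j + 1) → Fin n, x j f P *
        ∑ a, (t (f a) - s (f a))) / ((j + 1 : ℕ).factorial : ℝ)) =
        2 * (c j * ((∑ f : Fin (j + 1) → Fin n, x j f Q * ∑ a, (t (f a) - s (f a))) /
          ((j + 1 : ℕ).factorial : ℝ)) - c j * ((∑ f : Fin (j + 1) → Fin n, x j f P *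
            ∑ a, (t (f a) - s (f a))) / ((j + 1 : ℕ).factorial : ℝ))) := fun j => by ring
    rw [Finset.sum_congr rfl fun j _ => e5 j, ← Finset.mul_sum, Finset.sum_sub_distrib]
    simp only [hx, e1, sub_self, mul_zero]
  have hterm : ∀ j f, 0 ≤ (x j f Q - x j f P) *
      (Real.log (x j f Q₁) - Real.log (x j f P₁)) ∧ (x j f Q ≠ x j f P →
      0 < (x j f Q - x j f P) * (Real.log (x j f Q₁) - Real.log (x j f P₁))) := by
    intro j f
    by_cases hf : Function.Injective f
    · obtain ⟨κ, hκ⟩ := hQ₁.log_minor_sq (Nat.succ_le_of_lt j.2)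
      obtain ⟨κ', hκ'⟩ := hP₁.log_minor_sq (Nat.succ_le_of_lt j.2)
      have p1 := (hκ f (h₀ j f hf)).1
      have p2 := (hκ' f (h₀ j f hf)).1
      rcases lt_trichotomy (x j f Q) (x j f P) with h | h | h
      · have := mul_pos_of_neg_of_neg (sub_neg.2 h)
          (sub_neg.2 (Real.log_lt_log p1 ((hz j f).1 h)))
        exact ⟨this.le, fun _ => this⟩
      · exact ⟨by rw [h, sub_self, zero_mul], fun h' => absurd h h'⟩
      · have := mul_pos (sub_pos.2 h) (sub_pos.2 (Real.log_lt_log p2 ((hz j f).2 h)))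
        exact ⟨this.le, fun _ => this⟩
    · simp [hx, minor_eq_zero _ _ hf]
  refine hzero.not_gt (Finset.sum_pos' (fun j _ => ?_) ⟨j, Finset.mem_univ _, ?_⟩)
  · exact mul_nonneg (hc j).le (div_nonneg (Finset.sum_nonneg fun f _ => (hterm j f).1)
      (Nat.cast_nonneg _))
  · refine mul_pos (hc j) (div_pos (Finset.sum_pos' (fun f _ => (hterm j f).1)
      ⟨f, Finset.mem_univ _, (hterm j f).2 hne⟩) ?_)
    exact_mod_cast Nat.factorial_pos _

/-- The moment map is injective on the closure of a generic positive torus orbit. -/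
theorem moment_injOn_closure {lam : Fin n → ℝ} (hlam : StrictAnti lam)
    (h₀ : ∀ (j : Fin n) (f : Fin (j + 1) → Fin n), Function.Injective f →
      minor Q₀ (Nat.succ_le_of_lt j.2) f ≠ 0) :
    Set.InjOn (moment lam) (closure (orbit Q₀)) := by
  intro Q hQ P hP hm
  refine eq_of_minor_eq (transpose_mul_self_of_mem_closure hQ)
    (transpose_mul_self_of_mem_closure hP) fun j f => ?_
  by_cases hf : Function.Injective f
  · have h0 := h₀ j f hf
    have hs := minor_sq_eq_of_moment_eq hlam h₀ hQ hP hm j f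
    have h1 := minor_mul_nonneg_of_mem_closure hQ (Nat.succ_le_of_lt j.2) f
    have h2 := minor_mul_nonneg_of_mem_closure hP (Nat.succ_le_of_lt j.2) f
    refine mul_right_cancel₀ h0 ((sq_eq_sq₀ h1 h2).1 ?_)
    rw [mul_pow, mul_pow, hs]
  · rw [minor_eq_zero _ _ hf, minor_eq_zero _ _ hf]

end Injectivity

/-! ### The QR factorization and its smooth dependence on the matrix. -/

section GramSchmidt

open InnerProductSpace

variable {n : ℕ}

/-- The columns of a matrix as vectors of Euclidean space. -/
noncomputable def euclideanCol (A : Matrix (Fin n) (Fin n) ℝ) (j : Fin n) :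
    EuclideanSpace ℝ (Fin n) :=
  WithLp.toLp 2 fun i => A i j

/-- The orthogonal factor of the `QR` decomposition. -/
noncomputable def orthFactor (A : Matrix (Fin n) (Fin n) ℝ) : Matrix (Fin n) (Fin n) ℝ :=
  Matrix.of fun i j => gramSchmidtNormed ℝ (euclideanCol A) j i

theorem linearIndependent_euclideanCol {A : Matrix (Fin n) (Fin n) ℝ} (hA : A.det ≠ 0) :
    LinearIndependent ℝ (euclideanCol A) := by
  have h1 : LinearIndependent ℝ A.col :=
    Matrix.linearIndependent_cols_iff_isUnit.2 ((Matrix.isUnit_iff_isUnit_det A).2 hA.isUnit)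
  exact h1.map' (WithLp.linearEquiv 2 ℝ (Fin n → ℝ)).symm.toLinearMap
    (LinearEquiv.ker _)

theorem orthFactor_spec {A : Matrix (Fin n) (Fin n) ℝ} (hA : A.det ≠ 0) :
    (orthFactor A)ᵀ * orthFactor A = 1 ∧ ∃ R ∈ upPos n, orthFactor A * R = A := by
  have hli := linearIndependent_euclideanCol hA
  have hon := gramSchmidtNormed_orthonormal hli
  have h1 : (orthFactor A)ᵀ * orthFactor A = 1 := by
    ext a b
    have := orthonormal_iff_ite.1 hon a b
    rw [PiLp.inner_apply] at this
    simp only [Matrix.mul_apply, Matrix.transpose_apply, orthFactor, Matrix.of_apply,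
      Matrix.one_apply, ← this]
    refine Finset.sum_congr rfl fun i _ => ?_
    simp [mul_comm]
  have h2 : orthFactor A * (orthFactor A)ᵀ = 1 := mul_eq_one_comm.1 h1
  have hent : ∀ a b, ((orthFactor A)ᵀ * A) a b =
      inner ℝ (gramSchmidtNormed ℝ (euclideanCol A) a) (euclideanCol A b) := by
    intro a b
    rw [PiLp.inner_apply]
    simp only [Matrix.mul_apply, Matrix.transpose_apply, orthFactor, Matrix.of_apply]
    refine Finset.sum_congr rfl fun i _ => ?_
    simp [euclideanCol, mul_comm]
  refine ⟨h1, (orthFactor A)ᵀ * A, ⟨fun i j hij => ?_, fun i => ?_⟩, ?_⟩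
  · rw [hent, gramSchmidtNormed, inner_smul_left, gramSchmidt_inv_triangular ℝ _ hij, mul_zero]
  · have hne := gramSchmidt_ne_zero i hli
    rw [hent, gramSchmidtNormed, inner_smul_left]
    -- The column differs from its Gram–Schmidt vector by earlier, orthogonal ones. Hence the
    -- diagonal entry of `R` is the norm of that vector.
    have : inner ℝ (gramSchmidt ℝ (euclideanCol A) i) (euclideanCol A i) =
        ‖gramSchmidt ℝ (euclideanCol A) i‖ ^ 2 := by
      conv_lhs => rw [gramSchmidt_def'' ℝ (euclideanCol A) i]
      rw [inner_add_right, inner_sum, Finset.sum_eq_zero, add_zero, real_inner_self_eq_norm_sq]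
      intro k hk
      rw [inner_smul_right, gramSchmidt_orthogonal ℝ _ (Finset.mem_Iio.1 hk).ne', mul_zero]
    rw [this]
    have hpos := norm_pos_iff.2 hne
    refine mul_pos ?_ (by positivity)
    simpa using hpos
  · rw [← Matrix.mul_assoc, h2, Matrix.one_mul]

theorem contDiff_entry (i j : Fin n) :
    ContDiff ℝ ∞ fun A : Matrix (Fin n) (Fin n) ℝ => A i j :=
  contDiff_apply_apply ℝ ℝ i j

theorem contDiff_euclideanCol (j : Fin n) :
    ContDiff ℝ ∞ fun A : Matrix (Fin n) (Fin n) ℝ => euclideanCol A j :=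
  contDiff_euclidean.2 fun i => contDiff_entry i j

/-- The recursion divides only by squared norms of earlier vectors, which do not vanish at an
invertible matrix. -/
theorem contDiffAt_gramSchmidt {A : Matrix (Fin n) (Fin n) ℝ} (hA : A.det ≠ 0) (j : Fin n) :
    ContDiffAt ℝ ∞ (fun B => gramSchmidt ℝ (euclideanCol B) j) A := by
  have hli := linearIndependent_euclideanCol hA
  induction j using WellFoundedLT.induction with
  | _ j ih =>
    have hdef : (fun B : Matrix (Fin n) (Fin n) ℝ => gramSchmidt ℝ (euclideanCol B) j) =
        fun B => euclideanCol B j - ∑ i ∈ Finset.Iio j,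
          ((inner ℝ (gramSchmidt ℝ (euclideanCol B) i) (euclideanCol B j) : ℝ) /
            ‖gramSchmidt ℝ (euclideanCol B) i‖ ^ 2) • gramSchmidt ℝ (euclideanCol B) i := by
      funext B
      exact eq_sub_of_add_eq (gramSchmidt_def'' ℝ (euclideanCol B) j).symm
    rw [hdef]
    refine (contDiff_euclideanCol j).contDiffAt.sub (ContDiffAt.sum fun i hi => ?_)
    have hg := ih i (Finset.mem_Iio.1 hi)
    have hne := gramSchmidt_ne_zero i hli
    refine ContDiffAt.smul (ContDiffAt.div (hg.inner ℝ (contDiff_euclideanCol j).contDiffAt)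
      (hg.norm_sq ℝ) ?_) hg
    have := norm_pos_iff.2 hne
    positivity

theorem contDiffAt_orthFactor {A : Matrix (Fin n) (Fin n) ℝ} (hA : A.det ≠ 0) :
    ContDiffAt ℝ ∞ (orthFactor (n := n)) A := by
  refine contDiffAt_pi.2 fun i => contDiffAt_pi.2 fun j => ?_
  have hg := contDiffAt_gramSchmidt hA j
  have hne := gramSchmidt_ne_zero j (linearIndependent_euclideanCol hA)
  have h1 : ContDiffAt ℝ ∞ (fun B => gramSchmidtNormed ℝ (euclideanCol B) j) A :=
    ((hg.norm ℝ hne).inv (norm_ne_zero_iff.2 hne)).smul hg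
  exact contDiffAt_euclidean.1 h1 i

end GramSchmidt

/-! ### A polynomial formula for the BFR map. -/

section SmoothMatrix

variable {n : ℕ} {E : Type*} [NormedAddCommGroup E] [NormedSpace ℝ E]

theorem contDiffAt_matrix_mul {f g : E → Matrix (Fin n) (Fin n) ℝ} {x : E}
    (hf : ContDiffAt ℝ ∞ f x) (hg : ContDiffAt ℝ ∞ g x) :
    ContDiffAt ℝ ∞ (fun y => f y * g y) x := by
  refine contDiffAt_pi.2 fun i => contDiffAt_pi.2 fun j => ?_
  have h : (fun y => (f y * g y) i j) = fun y => ∑ a, f y i a * g y a j := by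
    funext y; rw [Matrix.mul_apply]
  rw [h]
  exact ContDiffAt.sum fun a _ => ((contDiff_entry i a).contDiffAt.comp x hf).mul
    ((contDiff_entry a j).contDiffAt.comp x hg)

theorem contDiffAt_matrix_transpose {f : E → Matrix (Fin n) (Fin n) ℝ} {x : E}
    (hf : ContDiffAt ℝ ∞ f x) : ContDiffAt ℝ ∞ (fun y => (f y)ᵀ) x :=
  contDiffAt_pi.2 fun i => contDiffAt_pi.2 fun j => (contDiff_entry j i).contDiffAt.comp x hf

theorem contDiff_matrix_pow (k : ℕ) :
    ContDiff ℝ ∞ fun A : Matrix (Fin n) (Fin n) ℝ => A ^ k := by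
  refine contDiff_iff_contDiffAt.2 fun A => ?_
  induction k with
  | zero => simpa using contDiffAt_const
  | succ k ih =>
    simp only [pow_succ]
    exact contDiffAt_matrix_mul ih contDiffAt_id

theorem contDiff_aeval (p : Polynomial ℝ) :
    ContDiff ℝ ∞ fun A : Matrix (Fin n) (Fin n) ℝ => Polynomial.aeval A p := by
  simp only [Polynomial.aeval_eq_sum_range]
  exact ContDiff.sum fun k _ => (contDiff_matrix_pow k).const_smul _

/-- A polynomial map which agrees with the BFR map on `𝒪_Λ`. -/
noncomputable def bfrPoly (lam : Fin n → ℝ) (S : Matrix (Fin n) (Fin n) ℝ) : Fin n → ℝ :=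
  fun i => ∑ a, lam a * Polynomial.aeval S (Lagrange.basis Finset.univ lam i) a a

theorem contDiff_bfrPoly (lam : Fin n → ℝ) : ContDiff ℝ ∞ (bfrPoly lam) :=
  contDiff_pi.2 fun _ => ContDiff.sum fun a _ =>
    contDiff_const.mul ((contDiff_entry a a).comp (contDiff_aeval _))

theorem aeval_transpose_mul_diagonal_mul {Q : Matrix (Fin n) (Fin n) ℝ} (hQ : Qᵀ * Q = 1)
    (lam : Fin n → ℝ) (p : Polynomial ℝ) :
    Polynomial.aeval (Qᵀ * Matrix.diagonal lam * Q) p =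
      Qᵀ * Matrix.diagonal (fun i => p.eval (lam i)) * Q := by
  have hQ' : Q * Qᵀ = 1 := mul_eq_one_comm.1 hQ
  induction p using Polynomial.induction_on' with
  | add p q hp hq =>
    rw [map_add, hp, hq, ← add_mul, ← mul_add, Matrix.diagonal_add]
    simp only [Polynomial.eval_add]
  | monomial k a =>
    have hpow : (Qᵀ * Matrix.diagonal lam * Q) ^ k =
        Qᵀ * Matrix.diagonal (fun i => lam i ^ k) * Q := by
      induction k with
      | zero => simp [hQ]
      | succ k ih =>
        rw [pow_succ, ih]
        calc Qᵀ * Matrix.diagonal (fun i => lam i ^ k) * Q * (Qᵀ * Matrix.diagonal lam * Q)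
            = Qᵀ * Matrix.diagonal (fun i => lam i ^ k) * (Q * Qᵀ) * Matrix.diagonal lam * Q := by
              simp only [Matrix.mul_assoc]
          _ = Qᵀ * (Matrix.diagonal (fun i => lam i ^ k) * Matrix.diagonal lam) * Q := by
              rw [hQ']; simp only [Matrix.mul_assoc, Matrix.one_mul]
          _ = _ := by rw [Matrix.diagonal_mul_diagonal]; simp only [pow_succ]
    rw [Polynomial.aeval_monomial, hpow, Algebra.algebraMap_eq_smul_one, smul_mul_assoc, one_mul]
    have : Matrix.diagonal (fun i => (Polynomial.monomial k a).eval (lam i)) =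
        a • Matrix.diagonal (fun i => lam i ^ k) := by
      rw [← Matrix.diagonal_smul]
      congr 1; funext i
      simp
    rw [this, mul_smul_comm, smul_mul_assoc]

/-- The `i`-th Lagrange basis polynomial sends `Qᵀ Λ Q` to the projection onto the `i`-th row of
`Q`, whose diagonal entries are `Q i a ^ 2`. -/
theorem bfrPoly_eq_moment {lam : Fin n → ℝ} (hlam : Function.Injective lam)
    {Q : Matrix (Fin n) (Fin n) ℝ} (hQ : Qᵀ * Q = 1) :
    bfrPoly lam (Qᵀ * Matrix.diagonal lam * Q) = moment lam Q := by
  have heval : ∀ i a, (Lagrange.basis Finset.univ lam i).eval (lam a) = if a = i then 1 else 0 := by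
    intro i a
    split_ifs with h
    · rw [h]; exact Lagrange.eval_basis_self hlam.injOn (Finset.mem_univ i)
    · exact Lagrange.eval_basis_of_ne (Ne.symm h) (Finset.mem_univ a)
  funext i
  refine Finset.sum_congr rfl fun a _ => ?_
  rw [aeval_transpose_mul_diagonal_mul hQ, Matrix.mul_apply]
  simp [heval, Matrix.mul_diagonal, sq]

theorem bfrPoly_eq_bfrMap {lam : Fin n → ℝ} (hlam : Function.Injective lam)
    {S : Matrix (Fin n) (Fin n) ℝ} (hS : S ∈ isospectral lam) : bfrPoly lam S = bfrMap lam S := by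
  obtain ⟨Q, hQ, rfl⟩ := (mem_isospectral_iff lam S).1 hS
  rw [bfrPoly_eq_moment hlam (mem_SO_iff.1 hQ).1, bfrMap_eq_moment hlam hQ]

end SmoothMatrix

/-! ### Derivatives of log-sum-exp along lines. -/

section LogSumExp

variable {ι : Type*} [Fintype ι]

theorem hasDerivAt_sum_exp (w α β γ : ι → ℝ) :
    HasDerivAt (fun s : ℝ => ∑ i, w i * Real.exp (2 * (α i + s * β i)) * γ i)
      (2 * ∑ i, w i * Real.exp (2 * α i) * (β i * γ i)) 0 := by
  have h : ∀ i ∈ (Finset.univ : Finset ι),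
      HasDerivAt (fun s : ℝ => w i * Real.exp (2 * (α i + s * β i)) * γ i)
      (2 * (w i * Real.exp (2 * α i) * (β i * γ i))) 0 := by
    intro i _
    have h1 : HasDerivAt (fun s : ℝ => 2 * (α i + s * β i)) (2 * (1 * β i)) 0 :=
      (((hasDerivAt_id (0 : ℝ)).mul_const (β i)).const_add (α i)).const_mul 2
    have h2 := ((h1.exp).const_mul (w i)).mul_const (γ i)
    refine h2.congr_deriv ?_
    simp only [zero_mul, add_zero]
    ring
  rw [Finset.mul_sum]
  exact HasDerivAt.fun_sum h

/-- The variance as a sum over pairs. For nonnegative `W`, its vanishing forces `β` to be constant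
where `W` is positive. -/
theorem sum_mul_sum_sub_sq (W β : ι → ℝ) :
    2 * ((∑ i, W i * (β i * β i)) * ∑ i, W i - (∑ i, W i * β i) ^ 2) =
      ∑ i, ∑ j, W i * W j * (β i - β j) ^ 2 := by
  have h : ∀ i j, W i * W j * (β i - β j) ^ 2 = W i * (β i * β i) * W j +
      W i * (W j * (β j * β j)) - 2 * ((W i * β i) * (W j * β j)) := fun i j => by ring
  simp only [h, Finset.sum_add_distrib, Finset.sum_sub_distrib, ← Finset.mul_sum,
    ← Finset.sum_mul]
  ring

variable {w : ι → ℝ} (α β : ι → ℝ)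

theorem hasDerivAt_half_log_sum_exp (hZ : 0 < ∑ i, w i * Real.exp (2 * α i)) :
    HasDerivAt (fun s : ℝ => 1 / 2 * Real.log (∑ i, w i * Real.exp (2 * (α i + s * β i))))
      ((∑ i, w i * Real.exp (2 * α i) * β i) / ∑ i, w i * Real.exp (2 * α i)) 0 := by
  have h1 := hasDerivAt_sum_exp w α β fun _ => 1
  simp only [mul_one] at h1
  have h2 := (h1.log (by simpa using hZ.ne')).const_mul (1 / 2)
  refine h2.congr_deriv ?_
  simp only [zero_mul, add_zero]
  field_simp

/-- The derivative is twice the variance of `β` under the Gibbs weights; the factor two comes from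
the exponent. -/
theorem hasDerivAt_mean (hZ : 0 < ∑ i, w i * Real.exp (2 * α i)) :
    HasDerivAt (fun s : ℝ => (∑ i, w i * Real.exp (2 * (α i + s * β i)) * β i) /
        ∑ i, w i * Real.exp (2 * (α i + s * β i)))
      ((∑ i, ∑ j, (w i * Real.exp (2 * α i)) * (w j * Real.exp (2 * α j)) * (β i - β j) ^ 2) /
        (∑ i, w i * Real.exp (2 * α i)) ^ 2) 0 := by
  have h1 := hasDerivAt_sum_exp w α β fun _ => 1
  simp only [mul_one] at h1
  have h2 := (hasDerivAt_sum_exp w α β β).div h1 (by simpa using hZ.ne')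
  refine h2.congr_deriv ?_
  rw [← sum_mul_sum_sub_sq]
  simp only [zero_mul, add_zero]
  ring

end LogSumExp

/-! ### The convex potential and local invertibility of its gradient. -/

section Potential

variable {n : ℕ} (w : (j : Fin n) → (Fin (j + 1) → Fin n) → ℝ) (c : Fin n → ℝ) (C : ℝ)

/-- The partition function of the weights `w j`. -/
noncomputable def partitionSum (j : Fin n) (t : Fin n → ℝ) : ℝ :=
  ∑ f : Fin (j + 1) → Fin n, w j f * Real.exp (2 * ∑ a, t (f a))

/-- The moment map in logarithmic coordinates of the torus. -/
noncomputable def orbitMoment (t : Fin n → ℝ) : Fin n → ℝ := fun i =>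
  C + ∑ j : Fin n, c j * ((∑ f : Fin (j + 1) → Fin n, w j f * Real.exp (2 * ∑ a, t (f a)) *
    ∑ a, (if f a = i then (1 : ℝ) else 0)) / partitionSum w j t)

/-- `orbitMoment`, extended transversally to the hyperplanes of constant trace. -/
noncomputable def extendedMoment (t : Fin n → ℝ) : Fin n → ℝ :=
  fun i => orbitMoment w c C t i + ∑ k, t k

/-- The potential of `orbitMoment`. -/
noncomputable def potential (t : Fin n → ℝ) : ℝ :=
  ∑ j, c j * (1 / 2 * Real.log (partitionSum w j t)) + C * ∑ i, t i

variable {w c C}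

theorem sum_mul_orbitMoment (h t : Fin n → ℝ) :
    ∑ i, h i * orbitMoment w c C t i = C * ∑ i, h i + ∑ j : Fin n, c j *
      ((∑ f : Fin (j + 1) → Fin n, w j f * Real.exp (2 * ∑ a, t (f a)) * ∑ a, h (f a)) /
        partitionSum w j t) := by
  have hf : ∀ (j : Fin n) (f : Fin (j + 1) → Fin n), ∑ a, h (f a) =
      ∑ i, h i * ∑ a, (if f a = i then (1 : ℝ) else 0) := by
    intro j f
    simp only [Finset.mul_sum]
    rw [Finset.sum_comm]
    simp
  simp only [orbitMoment, mul_add, Finset.sum_add_distrib, hf]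
  congr 1
  · rw [Finset.mul_sum]; exact Finset.sum_congr rfl fun i _ => mul_comm _ _
  · simp only [Finset.mul_sum (s := Finset.univ (α := Fin n))]
    rw [Finset.sum_comm]
    refine Finset.sum_congr rfl fun j _ => ?_
    rw [Finset.sum_comm, Finset.sum_div, Finset.mul_sum]
    refine Finset.sum_congr rfl fun i _ => ?_
    rw [mul_left_comm, ← mul_div_assoc, Finset.mul_sum]
    congr 2
    exact Finset.sum_congr rfl fun f _ => by ring

variable (hw0 : ∀ j f, 0 ≤ w j f) (hw : ∀ j f, Function.Injective f → 0 < w j f)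

include hw0 hw in
theorem partitionSum_pos (j : Fin n) (t : Fin n → ℝ) : 0 < partitionSum w j t := by
  refine Finset.sum_pos' (fun f _ => mul_nonneg (hw0 j f) (Real.exp_pos _).le)
    ⟨Fin.castLE (Nat.succ_le_of_lt j.2), Finset.mem_univ _,
      mul_pos (hw j _ (Fin.castLE_injective _)) (Real.exp_pos _)⟩

theorem contDiff_sum_apply {κ : Type*} [Fintype κ] (f : κ → Fin n) :
    ContDiff ℝ ∞ fun t : Fin n → ℝ => ∑ a, t (f a) :=
  ContDiff.sum fun a _ => contDiff_apply ℝ ℝ (f a)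

theorem contDiff_partitionSum (j : Fin n) : ContDiff ℝ ∞ (partitionSum w j) :=
  ContDiff.sum fun f _ => contDiff_const.mul (contDiff_const.mul (contDiff_sum_apply f)).exp

include hw0 hw in
theorem contDiff_extendedMoment : ContDiff ℝ ∞ (extendedMoment w c C) := by
  refine contDiff_pi.2 fun i => ContDiff.add (contDiff_const.add ?_) (contDiff_sum_apply id)
  refine ContDiff.sum fun j _ => contDiff_const.mul (ContDiff.div ?_ (contDiff_partitionSum j)
    fun t => (partitionSum_pos hw0 hw j t).ne')
  exact ContDiff.sum fun f _ =>
    (contDiff_const.mul (contDiff_const.mul (contDiff_sum_apply f)).exp).mul contDiff_const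

include hw0 hw in
theorem contDiff_potential : ContDiff ℝ ∞ (potential w c C) := by
  refine ContDiff.add (ContDiff.sum fun j _ => contDiff_const.mul (contDiff_const.mul
    ((contDiff_partitionSum j).log fun t => (partitionSum_pos hw0 hw j t).ne')))
    (contDiff_const.mul (contDiff_sum_apply id))

theorem sum_line {κ : Type*} [Fintype κ] (f : κ → Fin n) (t h : Fin n → ℝ) (s : ℝ) :
    ∑ a, (t + s • h) (f a) = ∑ a, t (f a) + s * ∑ a, h (f a) := by
  simp [Finset.sum_add_distrib, Finset.mul_sum]

include hw0 hw in
theorem hasDerivAt_potential (t h : Fin n → ℝ) :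
    HasDerivAt (fun s : ℝ => potential w c C (t + s • h))
      (∑ i, h i * orbitMoment w c C t i) 0 := by
  have h1 : HasDerivAt (fun s : ℝ => C * ∑ i, (t + s • h) i) (C * ∑ i, h i) 0 := by
    simp only [sum_line (fun i : Fin n => i)]
    simpa using (((hasDerivAt_id (0 : ℝ)).mul_const (∑ i, h i)).const_add (∑ i, t i)).const_mul C
  have h2 : ∀ j ∈ (Finset.univ : Finset (Fin n)),
      HasDerivAt (fun s : ℝ => c j * (1 / 2 * Real.log (partitionSum w j (t + s • h))))
      (c j * ((∑ f : Fin (j + 1) → Fin n, w j f * Real.exp (2 * ∑ a, t (f a)) * ∑ a, h (f a)) /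
        partitionSum w j t)) 0 := by
    intro j _
    simp only [partitionSum, sum_line]
    exact (hasDerivAt_half_log_sum_exp _ _ (partitionSum_pos hw0 hw j t)).const_mul (c j)
  rw [sum_mul_orbitMoment, add_comm]
  exact (HasDerivAt.fun_sum h2).add h1

include hw0 hw in
theorem hasDerivAt_sum_mul_extendedMoment (t h : Fin n → ℝ) :
    HasDerivAt (fun s : ℝ => ∑ i, h i * extendedMoment w c C (t + s • h) i)
      (∑ j : Fin n, c j * ((∑ f : Fin (j + 1) → Fin n, ∑ g : Fin (j + 1) → Fin n,
        (w j f * Real.exp (2 * ∑ a, t (f a))) * (w j g * Real.exp (2 * ∑ a, t (g a))) *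
          (∑ a, h (f a) - ∑ a, h (g a)) ^ 2) / partitionSum w j t ^ 2) +
        (∑ i, h i) * ∑ i, h i) 0 := by
  have h1 : HasDerivAt (fun s : ℝ => (∑ i, h i) * ∑ i, (t + s • h) i)
      ((∑ i, h i) * ∑ i, h i) 0 := by
    simp only [sum_line (fun i : Fin n => i)]
    simpa using (((hasDerivAt_id (0 : ℝ)).mul_const (∑ i, h i)).const_add (∑ i, t i)).const_mul
      (∑ i, h i)
  have h2 : HasDerivAt (fun s : ℝ => ∑ i, h i * orbitMoment w c C (t + s • h) i)
      (∑ j : Fin n, c j * ((∑ f : Fin (j + 1) → Fin n, ∑ g : Fin (j + 1) → Fin n,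
        (w j f * Real.exp (2 * ∑ a, t (f a))) * (w j g * Real.exp (2 * ∑ a, t (g a))) *
          (∑ a, h (f a) - ∑ a, h (g a)) ^ 2) / partitionSum w j t ^ 2)) 0 := by
    simp only [sum_mul_orbitMoment]
    refine HasDerivAt.const_add _ (HasDerivAt.fun_sum fun j _ => HasDerivAt.const_mul _ ?_)
    simp only [partitionSum, sum_line]
    exact hasDerivAt_mean _ _ (partitionSum_pos hw0 hw j t)
  have he : (fun s : ℝ => ∑ i, h i * extendedMoment w c C (t + s • h) i) =
      (fun s => ∑ i, h i * orbitMoment w c C (t + s • h) i) +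
        fun s => (∑ i, h i) * ∑ i, (t + s • h) i := by
    funext s
    simp only [extendedMoment, mul_add, Finset.sum_add_distrib, Finset.sum_mul, Pi.add_apply]
  rw [he]
  exact h2.add h1

include hw0 hw in
-- The quadratic form of the derivative at `h` is a positive combination of variances plus the
-- square of `∑ h`. If it vanishes, then `h` is constant and has sum zero.
theorem injective_fderiv_extendedMoment (hc : ∀ j, 0 < c j) (t : Fin n → ℝ) :
    Function.Injective (fderiv ℝ (extendedMoment w c C) t) := by
  rw [injective_iff_map_eq_zero]
  intro h hh
  have hd : HasFDerivAt (extendedMoment w c C) (fderiv ℝ (extendedMoment w c C) t) t :=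
    ((contDiff_extendedMoment hw0 hw).differentiable (by simp) t).hasFDerivAt
  have hline : HasDerivAt (fun s : ℝ => t + s • h) h 0 := by
    simpa using ((hasDerivAt_id (0 : ℝ)).smul_const h).const_add t
  have hd' : HasFDerivAt (extendedMoment w c C) (fderiv ℝ (extendedMoment w c C) t)
      (t + (0 : ℝ) • h) := by simpa using hd
  have hcomp := hd'.comp_hasDerivAt (0 : ℝ) hline
  rw [hh] at hcomp
  have h0 : HasDerivAt (fun s : ℝ => ∑ i, h i * extendedMoment w c C (t + s • h) i)
      (∑ i, h i * (0 : Fin n → ℝ) i) 0 :=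
    HasDerivAt.fun_sum fun i _ => (hasDerivAt_pi.1 hcomp i).const_mul (h i)
  have he := h0.unique (hasDerivAt_sum_mul_extendedMoment hw0 hw t h)
  simp only [Pi.zero_apply, mul_zero, Finset.sum_const_zero] at he
  have hnn : ∀ (j : Fin n) (f g : Fin (j + 1) → Fin n), 0 ≤
      (w j f * Real.exp (2 * ∑ a, t (f a))) * (w j g * Real.exp (2 * ∑ a, t (g a))) *
          (∑ a, h (f a) - ∑ a, h (g a)) ^ 2 := fun j f g =>
    mul_nonneg (mul_nonneg (mul_nonneg (hw0 j f) (Real.exp_pos _).le)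
      (mul_nonneg (hw0 j g) (Real.exp_pos _).le)) (sq_nonneg _)
  have hj : ∀ j : Fin n, 0 ≤ c j * ((∑ f : Fin (j + 1) → Fin n, ∑ g : Fin (j + 1) → Fin n,
        (w j f * Real.exp (2 * ∑ a, t (f a))) * (w j g * Real.exp (2 * ∑ a, t (g a))) *
          (∑ a, h (f a) - ∑ a, h (g a)) ^ 2) / partitionSum w j t ^ 2) := fun j =>
    mul_nonneg (hc j).le (div_nonneg (Finset.sum_nonneg fun f _ => Finset.sum_nonneg fun g _ =>
      hnn j f g) (sq_nonneg _))
  have hsum := Finset.sum_nonneg fun j (_ : j ∈ Finset.univ) => hj j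
  have hs0 : ∑ i, h i = 0 := by nlinarith [mul_self_nonneg (∑ i, h i)]
  rw [hs0, mul_zero, add_zero] at he
  have hall := (Finset.sum_eq_zero_iff_of_nonneg fun j _ => hj j).1 he.symm
  have hconst : ∀ i k, h i = h k := by
    intro i k
    have hn : 0 < n := i.pos
    -- The lowest level already suffices: there `f` ranges over single indices, and the pair of
    -- constant maps `i`, `k` compares `h i` with `h k`.
    have h1 := hall ⟨0, hn⟩ (Finset.mem_univ _)
    have h2 := (mul_eq_zero.1 h1).resolve_left (hc _).ne'
    have h3 := (div_eq_zero_iff.1 h2).resolve_right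
      (pow_ne_zero 2 (partitionSum_pos hw0 hw _ t).ne')
    have h4 := (Finset.sum_eq_zero_iff_of_nonneg fun f _ => Finset.sum_nonneg fun g _ =>
      hnn _ f g).1 h3 (fun _ => i) (Finset.mem_univ _)
    have h5 := (Finset.sum_eq_zero_iff_of_nonneg fun g _ => hnn _ _ g).1 h4 (fun _ => k)
      (Finset.mem_univ _)
    have hinj : ∀ i : Fin n, Function.Injective fun _ : Fin ((⟨0, hn⟩ : Fin n) + 1) => i :=
      fun i a b _ => Fin.ext (by have := a.2; have := b.2; simp at *)
    have h6 := (mul_eq_zero.1 h5).resolve_left (mul_pos (mul_pos (hw _ _ (hinj i))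
      (Real.exp_pos _)) (mul_pos (hw _ _ (hinj k)) (Real.exp_pos _))).ne'
    have h7 := pow_eq_zero_iff two_ne_zero |>.1 h6
    simpa [sub_eq_zero] using h7
  funext i
  have : ∑ k, h k = n * h i := by
    rw [Finset.sum_congr rfl fun k _ => hconst k i]; simp
  rw [hs0] at this
  have hn : (n : ℝ) ≠ 0 := by exact_mod_cast i.pos.ne'
  exact (mul_eq_zero.1 this.symm).resolve_left hn

include hw0 hw in
/-- `extendedMoment` has smooth local right inverses; in particular it is an open map. -/
theorem exists_local_inverse (hc : ∀ j, 0 < c j) (t : Fin n → ℝ) :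
    ∃ U : Set (Fin n → ℝ), IsOpen U ∧ extendedMoment w c C t ∈ U ∧
      ∃ σ : (Fin n → ℝ) → (Fin n → ℝ), ContDiffOn ℝ ∞ σ U ∧
        ∀ y ∈ U, extendedMoment w c C (σ y) = y := by
  have hG := contDiff_extendedMoment (c := c) (C := C) hw0 hw
  let e : (Fin n → ℝ) → (Fin n → ℝ) ≃L[ℝ] (Fin n → ℝ) := fun s =>
    (LinearEquiv.ofInjectiveEndo (fderiv ℝ (extendedMoment w c C) s).toLinearMap
      (injective_fderiv_extendedMoment hw0 hw hc s)).toContinuousLinearEquiv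
  have he : ∀ s, HasFDerivAt (extendedMoment w c C)
      (e s : (Fin n → ℝ) →L[ℝ] (Fin n → ℝ)) s := by
    intro s
    have : (e s : (Fin n → ℝ) →L[ℝ] (Fin n → ℝ)) = fderiv ℝ (extendedMoment w c C) s := by
      ext1 v; rfl
    rw [this]
    exact (hG.differentiable (by simp) s).hasFDerivAt
  let φ := hG.contDiffAt.toOpenPartialHomeomorph (extendedMoment w c C) (he t) (by simp)
  refine ⟨φ.target, φ.open_target,
    hG.contDiffAt.image_mem_toOpenPartialHomeomorph_target (he t) (by simp), φ.symm, ?_, ?_⟩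
  · intro y hy
    exact (φ.contDiffAt_symm hy (he _) hG.contDiffAt).contDiffWithinAt
  · intro y hy
    exact φ.right_inv hy

end Potential

/-! ### The permutohedron and its relative interior. -/

section Permutohedron

variable {n : ℕ} {lam : Fin n → ℝ}

theorem perm_mem_permutohedron (π : Equiv.Perm (Fin n)) :
    (fun i => lam (π i)) ∈ permutohedron lam :=
  subset_convexHull ℝ _ ⟨π, rfl⟩

theorem sum_eq_of_mem_permutohedron {y : Fin n → ℝ} (hy : y ∈ permutohedron lam) :
    ∑ i, y i = ∑ i, lam i := by
  have hconv : Convex ℝ {y : Fin n → ℝ | ∑ i, y i = ∑ i, lam i} := by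
    intro x hx y hy a b _ _ hab
    simp only [Set.mem_ofPred_eq] at hx hy ⊢
    simp only [Pi.add_apply, Pi.smul_apply, smul_eq_mul, Finset.sum_add_distrib,
      ← Finset.mul_sum, hx, hy]
    rw [← add_mul, hab, one_mul]
  refine convexHull_min ?_ hconv hy
  rintro _ ⟨π, rfl⟩
  exact Equiv.sum_comp π lam

/-- The easy half of the Schur–Horn theorem. -/
theorem moment_mem_permutohedron {Q : Matrix (Fin n) (Fin n) ℝ} (hQ : Qᵀ * Q = 1) :
    moment lam Q ∈ permutohedron lam := by
  have hQ' : Q * Qᵀ = 1 := mul_eq_one_comm.1 hQ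
  set M : Matrix (Fin n) (Fin n) ℝ := Matrix.of fun i a => Q i a ^ 2 with hM
  have hds : M ∈ doublyStochastic ℝ (Fin n) := by
    rw [mem_doublyStochastic_iff_sum]
    refine ⟨fun i j => sq_nonneg _, fun i => ?_, fun j => ?_⟩
    · have := congrFun (congrFun hQ' i) i
      rw [Matrix.mul_apply, Matrix.one_apply_eq] at this
      simpa [hM, sq] using this
    · have := congrFun (congrFun hQ j) j
      rw [Matrix.mul_apply, Matrix.one_apply_eq] at this
      simpa [hM, sq] using this
  have hds' : M ∈ (doublyStochastic ℝ (Fin n) : Set (Matrix (Fin n) (Fin n) ℝ)) := hds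
  rw [doublyStochastic_eq_convexHull_permMatrix] at hds'
  let L : Matrix (Fin n) (Fin n) ℝ →ₗ[ℝ] (Fin n → ℝ) :=
    { toFun := fun A => A.mulVec lam
      map_add' := fun A B => Matrix.add_mulVec A B lam
      map_smul' := fun r A => Matrix.smul_mulVec r A lam }
  have hL : L M = moment lam Q := by
    funext i
    change (M.mulVec lam) i = _
    simp only [Matrix.mulVec, dotProduct, moment, hM, Matrix.of_apply]
    exact Finset.sum_congr rfl fun a _ => mul_comm _ _
  rw [← hL]
  have h2 : L M ∈ L '' convexHull ℝ {σ.permMatrix ℝ | σ : Equiv.Perm (Fin n)} := ⟨M, hds', rfl⟩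
  rw [L.image_convexHull] at h2
  refine convexHull_mono ?_ h2
  rintro _ ⟨_, ⟨σ, rfl⟩, rfl⟩
  refine ⟨σ, ?_⟩
  funext i
  change _ = ((σ.permMatrix ℝ).mulVec lam) i
  rw [Matrix.permMatrix_mulVec]
  rfl

/-- Points of the relative interior can be moved in the direction of all roots. -/
theorem exists_shift_of_mem_intrinsicInterior (hlam : Function.Injective lam) {x : Fin n → ℝ}
    (hx : x ∈ intrinsicInterior ℝ (permutohedron lam)) :
    ∃ ε : ℝ, 0 < ε ∧ ∀ i j,
      x + ε • (Pi.single i (1 : ℝ) - Pi.single j (1 : ℝ)) ∈ permutohedron lam := by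
  have key : ∀ i j, ∀ᶠ ε in nhds (0 : ℝ),
      x + ε • (Pi.single i (1 : ℝ) - Pi.single j (1 : ℝ)) ∈ permutohedron lam := by
    intro i j
    obtain ⟨y, hy, hyx⟩ := mem_intrinsicInterior.1 hx
    have hdir : (Pi.single i (1 : ℝ) - Pi.single j (1 : ℝ) : Fin n → ℝ) ∈
        (affineSpan ℝ (permutohedron lam)).direction := by
      by_cases hij : i = j
      · subst hij; simp
      · have h1 : (fun k => lam ((1 : Equiv.Perm (Fin n)) k)) ∈
            affineSpan ℝ (permutohedron lam) :=
          subset_affineSpan ℝ _ (perm_mem_permutohedron 1)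
        have h2 : (fun k => lam (Equiv.swap i j k)) ∈ affineSpan ℝ (permutohedron lam) :=
          subset_affineSpan ℝ _ (perm_mem_permutohedron _)
        have h3 := AffineSubspace.vsub_mem_direction h1 h2
        -- Two vertices differing by a transposition differ by `lam i - lam j` times the root.
        have h4 := Submodule.smul_mem _ (lam i - lam j)⁻¹ h3
        have hne : lam i - lam j ≠ 0 := sub_ne_zero.2 fun e => hij (hlam e)
        convert h4 using 1
        funext k
        simp only [vsub_eq_sub, Pi.sub_apply, Pi.smul_apply, smul_eq_mul, Equiv.Perm.one_apply]
        rcases eq_or_ne k i with rfl | hki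
        · rw [Equiv.swap_apply_left]; simp [hij, hne]
        · rcases eq_or_ne k j with rfl | hkj
          · rw [Equiv.swap_apply_right, ← neg_sub (lam i), mul_neg, inv_mul_cancel₀ hne]; simp [hki]
          · rw [Equiv.swap_apply_of_ne_of_ne hki hkj]; simp [hki, hkj]
    let γ : ℝ → affineSpan ℝ (permutohedron lam) := fun ε =>
      ⟨x + ε • (Pi.single i (1 : ℝ) - Pi.single j (1 : ℝ)), by
        rw [add_comm, ← vadd_eq_add]
        exact AffineSubspace.vadd_mem_of_mem_direction (Submodule.smul_mem _ ε hdir)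
          (hyx ▸ y.2)⟩
    have hγ : Continuous γ := by
      refine Continuous.subtype_mk ?_ _
      fun_prop
    have hγ0 : γ 0 = y := Subtype.ext (by simp [γ, hyx])
    have hnh := mem_interior_iff_mem_nhds.1 hy
    rw [← hγ0] at hnh
    exact hγ.continuousAt hnh
  have hall : ∀ᶠ ε in nhds (0 : ℝ), ∀ i j,
      x + ε • (Pi.single i (1 : ℝ) - Pi.single j (1 : ℝ)) ∈ permutohedron lam :=
    Filter.eventually_all.2 fun i => Filter.eventually_all.2 fun j => key i j
  obtain ⟨ε, hε, hpos⟩ := ((hall.filter_mono nhdsWithin_le_nhds).and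
    (self_mem_nhdsWithin (s := Set.Ioi (0 : ℝ)))).exists
  exact ⟨ε, hpos, hε⟩

/-- A relatively open subset of the hyperplane of constant trace that lies in the permutohedron
lies in its relative interior. -/
theorem mem_intrinsicInterior_of_isOpen {U : Set (Fin n → ℝ)} (hU : IsOpen U) {x : Fin n → ℝ}
    (hx : x ∈ U) (hxP : x ∈ permutohedron lam)
    (h : ∀ z ∈ U, ∑ i, z i = ∑ i, lam i → z ∈ permutohedron lam) :
    x ∈ intrinsicInterior ℝ (permutohedron lam) := by
  refine mem_intrinsicInterior.2 ⟨⟨x, subset_affineSpan ℝ _ hxP⟩, ?_, rfl⟩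
  refine mem_interior.2 ⟨Subtype.val ⁻¹' U, ?_, hU.preimage continuous_subtype_val, hx⟩
  rintro ⟨z, hz⟩ hzU
  refine h z hzU ?_
  let L : (Fin n → ℝ) →ₗ[ℝ] ℝ := ∑ i, LinearMap.proj i
  have hL : ∀ v, L v = ∑ i, v i := fun v => by simp [L]
  have hmem : z ∈ (AffineSubspace.mk' lam (LinearMap.ker L) : AffineSubspace ℝ (Fin n → ℝ)) := by
    refine affineSpan_le.2 ?_ hz
    intro v hv
    rw [SetLike.mem_coe, AffineSubspace.mem_mk', LinearMap.mem_ker, vsub_eq_sub, map_sub, hL, hL,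
      sum_eq_of_mem_permutohedron hv, sub_self]
  rw [AffineSubspace.mem_mk', LinearMap.mem_ker, vsub_eq_sub, map_sub, hL, hL] at hmem
  exact sub_eq_zero.1 hmem

end Permutohedron

/-! ### Surjectivity onto the relative interior by minimization. -/

section Coercive

variable {n : ℕ} {w : (j : Fin n) → (Fin (j + 1) → Fin n) → ℝ} {c lam : Fin n → ℝ} {C : ℝ}

/-- Up to a constant the potential dominates the support function of the permutohedron. The claim is
affine in `y`, so only vertices matter, and at a vertex one term of each partition function is
enough. Positivity of all weights on injective maps is essential here. -/
theorem exists_potential_lower_bound (hw0 : ∀ j f, 0 ≤ w j f)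
    (hw : ∀ j f, Function.Injective f → 0 < w j f) (hc : ∀ j, 0 < c j)
    (hlam : ∀ a, lam a = C + ∑ j ∈ Finset.Ici a, c j) :
    ∃ K : ℝ, ∀ t : Fin n → ℝ, ∀ y ∈ permutohedron lam,
      ∑ i, t i * y i - K ≤ potential w c C t := by
  refine ⟨∑ j, c j * ∑ f : Fin (j + 1) → Fin n, 1 / 2 * |Real.log (w j f)|, fun t y hy => ?_⟩
  set K := ∑ j, c j * ∑ f : Fin (j + 1) → Fin n, 1 / 2 * |Real.log (w j f)|
  have hconv : Convex ℝ {y : Fin n → ℝ | ∑ i, t i * y i - K ≤ potential w c C t} := by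
    intro x hx y hy a b ha hb hab
    simp only [Set.mem_ofPred_eq] at hx hy ⊢
    have : ∑ i, t i * (a • x + b • y) i = a * ∑ i, t i * x i + b * ∑ i, t i * y i := by
      rw [Finset.mul_sum, Finset.mul_sum, ← Finset.sum_add_distrib]
      refine Finset.sum_congr rfl fun i _ => ?_
      simp only [Pi.add_apply, Pi.smul_apply, smul_eq_mul]; ring
    rw [this]
    have h1 := mul_le_mul_of_nonneg_left hx ha
    have h2 := mul_le_mul_of_nonneg_left hy hb
    have e1 : a * K + b * K = K := by rw [← add_mul, hab, one_mul]
    have e2 : a * potential w c C t + b * potential w c C t = potential w c C t := by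
      rw [← add_mul, hab, one_mul]
    linarith
  refine convexHull_min ?_ hconv hy
  rintro _ ⟨π, rfl⟩
  have h1 : ∑ i, t i * lam (π i) = ∑ a, lam a * t (π.symm a) := by
    rw [← Equiv.sum_comp π fun a => lam a * t (π.symm a)]
    exact Finset.sum_congr rfl fun i _ => by rw [Equiv.symm_apply_apply, mul_comm]
  simp only [Set.mem_ofPred_eq]
  rw [h1, sum_mul_eq_of_weights hlam, Equiv.sum_comp π.symm t, potential]
  have h2 : ∀ j : Fin n,
      c j * ∑ a : Fin (j + 1), t (π.symm (Fin.castLE (Nat.succ_le_of_lt j.2) a)) -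
      c j * ∑ f : Fin (j + 1) → Fin n, 1 / 2 * |Real.log (w j f)| ≤
      c j * (1 / 2 * Real.log (partitionSum w j t)) := by
    intro j
    rw [← mul_sub]
    refine mul_le_mul_of_nonneg_left ?_ (hc j).le
    -- The term of the partition function attached to the vertex `π`: the positions of the `j + 1`
    -- largest entries.
    set f₀ : Fin (j + 1) → Fin n := fun a => π.symm (Fin.castLE (Nat.succ_le_of_lt j.2) a) with hf₀
    have hinj : Function.Injective f₀ :=
      π.symm.injective.comp (Fin.castLE_injective _)
    have h3 : w j f₀ * Real.exp (2 * ∑ a, t (f₀ a)) ≤ partitionSum w j t :=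
      Finset.single_le_sum (f := fun f => w j f * Real.exp (2 * ∑ a, t (f a)))
        (fun f _ => mul_nonneg (hw0 j f) (Real.exp_pos _).le) (Finset.mem_univ f₀)
    have h4 := Real.log_le_log (mul_pos (hw j f₀ hinj) (Real.exp_pos _)) h3
    rw [Real.log_mul (hw j f₀ hinj).ne' (Real.exp_pos _).ne', Real.log_exp] at h4
    have h5 : 1 / 2 * |Real.log (w j f₀)| ≤
        ∑ f : Fin (j + 1) → Fin n, 1 / 2 * |Real.log (w j f)| :=
      Finset.single_le_sum (f := fun f => 1 / 2 * |Real.log (w j f)|)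
        (fun f _ => by positivity) (Finset.mem_univ f₀)
    have h6 := neg_abs_le (Real.log (w j f₀))
    linarith
  have h3 := Finset.sum_le_sum fun j (_ : j ∈ Finset.univ) => h2 j
  rw [Finset.sum_sub_distrib] at h3
  linarith

theorem exists_extendedMoment_eq (hw0 : ∀ j f, 0 ≤ w j f)
    (hw : ∀ j f, Function.Injective f → 0 < w j f) (hc : ∀ j, 0 < c j)
    (hlam : ∀ a, lam a = C + ∑ j ∈ Finset.Ici a, c j) {x : Fin n → ℝ} {ε : ℝ} (hε : 0 < ε)
    (hx : ∀ i j, x + ε • (Pi.single i (1 : ℝ) - Pi.single j (1 : ℝ)) ∈ permutohedron lam) :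
    ∃ t, extendedMoment w c C t = x := by
  obtain ⟨K, hK⟩ := exists_potential_lower_bound hw0 hw hc hlam
  -- The gradient of `g` is `extendedMoment - x`. The quadratic term supplies growth along the
  -- constant vectors; the shifted points in `hx` supply it in every other direction.
  set g : (Fin n → ℝ) → ℝ := fun t =>
    potential w c C t - ∑ i, t i * x i + 1 / 2 * (∑ i, t i) ^ 2 with hg
  have hgc : Continuous g := by
    have := (contDiff_potential (c := c) (C := C) hw0 hw).continuous
    fun_prop
  have hlow : ∀ t i j, ε * (t i - t j) - K + 1 / 2 * (∑ i, t i) ^ 2 ≤ g t := by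
    intro t i j
    have h1 := hK t _ (hx i j)
    have h2 : ∑ k, t k * (x + ε • (Pi.single i (1 : ℝ) - Pi.single j (1 : ℝ)) : Fin n → ℝ) k =
        ∑ k, t k * x k + ε * (t i - t j) := by
      have : ∀ k, t k * (x + ε • (Pi.single i (1 : ℝ) - Pi.single j (1 : ℝ)) : Fin n → ℝ) k =
          t k * x k + ε * (t k * (Pi.single i (1 : ℝ) : Fin n → ℝ) k -
            t k * (Pi.single j (1 : ℝ) : Fin n → ℝ) k) := fun k => by
        simp only [Pi.add_apply, Pi.smul_apply, Pi.sub_apply, smul_eq_mul]; ring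
      simp only [this, Finset.sum_add_distrib, ← Finset.mul_sum, Finset.sum_sub_distrib]
      simp [Pi.single_apply]
    rw [h2] at h1
    simp only [hg]
    linarith
  -- Since `n * t i` is the sum of all `t i - t j` plus `∑ t`, the first summand bounds the
  -- differences and the second bounds `|∑ t|`, through `|s| ≤ 1 + s ^ 2`.
  set B := (g 0 + K) / ε + (1 + 2 * (g 0 + K)) with hB
  have hbdd : Bornology.IsBounded {t | g t ≤ g 0} := by
    refine (Metric.isBounded_Icc (fun _ => -B) (fun _ => B)).subset fun t ht => ?_
    have hn : ∀ i : Fin n, (1 : ℝ) ≤ n := fun i => by exact_mod_cast i.pos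
    have hd : ∀ i j, t i - t j ≤ (g 0 + K) / ε := by
      intro i j
      rw [le_div_iff₀ hε]
      have := (hlow t i j).trans ht
      nlinarith [sq_nonneg (∑ i, t i)]
    have hs : ∀ i : Fin n, |∑ i, t i| ≤ 1 + 2 * (g 0 + K) := by
      intro i
      have := (hlow t i i).trans ht
      rw [sub_self, mul_zero] at this
      have h1 : |∑ i, t i| ≤ 1 + (∑ i, t i) ^ 2 := by
        rw [← sq_abs]
        nlinarith [sq_nonneg (|∑ i, t i| - 1), abs_nonneg (∑ i, t i)]
      linarith
    have hup : ∀ s : ℝ, (s = 1 ∨ s = -1) → ∀ i, s * t i ≤ B := by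
      intro s hs1 i
      have h1 : (n : ℝ) * (s * t i) = ∑ j, s * (t i - t j) + s * ∑ j, t j := by
        rw [Finset.mul_sum, ← Finset.sum_add_distrib]
        have : ∀ j, s * (t i - t j) + s * t j = s * t i := fun j => by ring
        simp [this]
      have h2 : ∑ j, s * (t i - t j) ≤ n * ((g 0 + K) / ε) := by
        have := Finset.sum_le_card_nsmul Finset.univ (fun j => s * (t i - t j)) ((g 0 + K) / ε)
          fun j _ => by
            rcases hs1 with rfl | rfl
            · simpa using hd i j
            · simpa using hd j i
        simpa using this
      have h3 : s * ∑ j, t j ≤ 1 + 2 * (g 0 + K) := by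
        have := abs_le.1 (hs i)
        rcases hs1 with rfl | rfl <;> linarith
      have h4 : 0 ≤ 1 + 2 * (g 0 + K) := (abs_nonneg _).trans (hs i)
      have h5 : (n : ℝ) * (s * t i) ≤ n * B := by
        rw [hB, mul_add]
        nlinarith [hn i]
      exact le_of_mul_le_mul_left h5 (by linarith [hn i])
    refine ⟨fun i => ?_, fun i => ?_⟩
    · have := hup (-1) (Or.inr rfl) i
      linarith
    · have := hup 1 (Or.inl rfl) i
      linarith
  obtain ⟨t, ht⟩ := hgc.exists_forall_le_of_isBounded 0 hbdd
  refine ⟨t, funext fun k => ?_⟩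
  set h : Fin n → ℝ := Pi.single k 1 with hh
  have hsum : ∀ v : Fin n → ℝ, ∑ i, h i * v i = v k := fun v => by
    simp [hh, Pi.single_apply]
  have hsum1 : ∑ i, h i = 1 := by simp [hh]
  have h1 := hasDerivAt_potential (c := c) (C := C) hw0 hw t h
  have h2 : HasDerivAt (fun s : ℝ => ∑ i, (t + s • h) i * x i) (∑ i, h i * x i) 0 := by
    have : (fun s : ℝ => ∑ i, (t + s • h) i * x i) =
        fun s => ∑ i, t i * x i + s * ∑ i, h i * x i := by
      funext s
      rw [Finset.mul_sum, ← Finset.sum_add_distrib]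
      refine Finset.sum_congr rfl fun i _ => ?_
      simp only [Pi.add_apply, Pi.smul_apply, smul_eq_mul]; ring
    rw [this]
    simpa using ((hasDerivAt_id (0 : ℝ)).mul_const (∑ i, h i * x i)).const_add (∑ i, t i * x i)
  have h3 : HasDerivAt (fun s : ℝ => 1 / 2 * (∑ i, (t + s • h) i) ^ 2) (∑ i, t i) 0 := by
    have : (fun s : ℝ => 1 / 2 * (∑ i, (t + s • h) i) ^ 2) =
        fun s => 1 / 2 * (∑ i, t i + s) ^ 2 := by
      funext s
      rw [sum_line (fun i : Fin n => i), hsum1, mul_one]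
    rw [this]
    refine ((((hasDerivAt_id (0 : ℝ)).const_add (∑ i, t i)).pow 2).const_mul (1 / 2)).congr_deriv ?_
    simp
  have h4 := (h1.sub h2).add h3
  have hmin : IsLocalMin ((fun s : ℝ => potential w c C (t + s • h)) -
      (fun s : ℝ => ∑ i, (t + s • h) i * x i) + fun s => 1 / 2 * (∑ i, (t + s • h) i) ^ 2) 0 := by
    refine Filter.Eventually.of_forall fun s => ?_
    have := ht (t + s • h)
    simpa [hg] using this
  have h5 := hmin.hasDerivAt_eq_zero h4
  rw [hsum, hsum] at h5
  rw [extendedMoment]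
  linarith

end Coercive

/-! ### The homeomorphism from the closure of a slice onto the permutohedron. -/

section Slice

variable {n : ℕ} {Q₀ Q : Matrix (Fin n) (Fin n) ℝ} {lam c t : Fin n → ℝ} {C : ℝ}

/-- Squared minors on the first columns, as weights. -/
noncomputable def minorWeight (Q₀ : Matrix (Fin n) (Fin n) ℝ) (j : Fin n)
    (f : Fin (j + 1) → Fin n) : ℝ :=
  minor Q₀ (Nat.succ_le_of_lt j.2) f ^ 2

/-- The unknown scalar `ρ` cancels: its square also multiplies the partition function, because the
squared minors of `Q` have total `(j + 1)!`. -/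
theorem IsOrbitPoint.moment_eq (hlam : ∀ a, lam a = C + ∑ j ∈ Finset.Ici a, c j)
    (h : IsOrbitPoint Q₀ t Q) : moment lam Q = orbitMoment (minorWeight Q₀) c C t := by
  have hj : ∀ (j : Fin n) (v : Fin n → ℝ),
      (∑ f : Fin (j + 1) → Fin n, minor Q (Nat.succ_le_of_lt j.2) f ^ 2 * ∑ a, v (f a)) /
        ((j + 1 : ℕ).factorial : ℝ) =
      (∑ f : Fin (j + 1) → Fin n, minorWeight Q₀ j f * Real.exp (2 * ∑ a, t (f a)) *
        ∑ a, v (f a)) / partitionSum (minorWeight Q₀) j t := by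
    intro j v
    obtain ⟨ρ, hρ, hf⟩ := h.minor_mul_eq (Nat.succ_le_of_lt j.2)
    have h1 : ∀ f, minorWeight Q₀ j f * Real.exp (2 * ∑ a, t (f a)) =
        ρ ^ 2 * minor Q (Nat.succ_le_of_lt j.2) f ^ 2 := by
      intro f
      have e : Real.exp (2 * ∑ a, t (f a)) = Real.exp (∑ a, t (f a)) ^ 2 := by
        rw [two_mul, Real.exp_add, sq]
      rw [e, minorWeight, ← mul_pow, mul_comm (minor Q₀ _ f), ← hf, mul_pow, mul_comm]
    have h2 : partitionSum (minorWeight Q₀) j t = ρ ^ 2 * ((j + 1 : ℕ).factorial : ℝ) := by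
      rw [partitionSum, Finset.sum_congr rfl fun f _ => h1 f, ← Finset.mul_sum, sum_minor_sq h.1]
    rw [h2]
    simp only [h1, mul_assoc, ← Finset.mul_sum]
    rw [mul_div_mul_left _ _ (by positivity)]
  funext i
  have h1 := sum_mul_moment hlam h.1 (Pi.single i 1)
  have h2 := sum_mul_orbitMoment (w := minorWeight Q₀) (c := c) (C := C) (Pi.single i 1) t
  simp only [hj] at h1
  rw [← h2] at h1
  simpa [Pi.single_apply] using h1

/-- The orthogonal factor of `exp(diag t) Q₀`. -/
noncomputable def orbitPoint (Q₀ : Matrix (Fin n) (Fin n) ℝ) (t : Fin n → ℝ) :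
    Matrix (Fin n) (Fin n) ℝ :=
  orthFactor (Matrix.diagonal (fun i => Real.exp (t i)) * Q₀)

theorem det_exp_mul_ne_zero (h₀ : Q₀.det ≠ 0) (t : Fin n → ℝ) :
    (Matrix.diagonal (fun i => Real.exp (t i)) * Q₀).det ≠ 0 := by
  rw [Matrix.det_mul, Matrix.det_diagonal]
  exact mul_ne_zero (Finset.prod_pos fun i _ => Real.exp_pos _).ne' h₀

theorem isOrbitPoint_orbitPoint (h₀ : Q₀.det ≠ 0) (t : Fin n → ℝ) :
    IsOrbitPoint Q₀ t (orbitPoint Q₀ t) :=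
  orthFactor_spec (det_exp_mul_ne_zero h₀ t)

theorem contDiffAt_orbitPoint (h₀ : Q₀.det ≠ 0) (t : Fin n → ℝ) :
    ContDiffAt ℝ ∞ (orbitPoint Q₀) t := by
  have h1 : ContDiffAt ℝ ∞ (fun t : Fin n → ℝ =>
      Matrix.diagonal (fun i => Real.exp (t i)) * Q₀) t := by
    refine contDiffAt_pi.2 fun i => contDiffAt_pi.2 fun j => ?_
    simp only [Matrix.diagonal_mul]
    exact ((contDiff_apply ℝ ℝ i).exp.mul contDiff_const).contDiffAt
  exact ContDiffAt.comp t (contDiffAt_orthFactor (det_exp_mul_ne_zero h₀ t)) h1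

/-- The orbit moment has the trace of `Λ`, so comparing traces identifies `s` with `∑ t` and removes
the transversal term. -/
theorem orbitMoment_eq_of_extendedMoment_eq_add (hlam : ∀ a, lam a = C + ∑ j ∈ Finset.Ici a, c j)
    (h₀ : Q₀.det ≠ 0) {z : Fin n → ℝ} {s : ℝ}
    (h : ∀ i, extendedMoment (minorWeight Q₀) c C t i = z i + s) (hz : ∑ i, z i = ∑ i, lam i) :
    orbitMoment (minorWeight Q₀) c C t = z := by
  have hm := (isOrbitPoint_orbitPoint h₀ t).moment_eq hlam
  have hs := sum_moment lam (isOrbitPoint_orbitPoint h₀ t).1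
  rw [hm] at hs
  have h1 : ∑ i, (orbitMoment (minorWeight Q₀) c C t i + ∑ k, t k) = ∑ i, (z i + s) :=
    Finset.sum_congr rfl fun i _ => h i
  simp only [Finset.sum_add_distrib, hs, hz, Finset.sum_const, Finset.card_univ,
    Fintype.card_fin, nsmul_eq_mul, add_right_inj] at h1
  funext i
  have hn : (n : ℝ) ≠ 0 := by exact_mod_cast i.pos.ne'
  have h2 := mul_left_cancel₀ hn h1
  have h3 := h i
  rw [extendedMoment, h2] at h3
  exact add_right_cancel h3

theorem abs_entry_le_one (hQ : Qᵀ * Q = 1) (i j : Fin n) : |Q i j| ≤ 1 := by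
  have := congrFun (congrFun hQ j) j
  rw [Matrix.mul_apply, Matrix.one_apply_eq] at this
  rw [abs_le_one_iff_mul_self_le_one, ← this]
  exact Finset.single_le_sum (f := fun i => Qᵀ j i * Q i j)
    (fun i _ => mul_self_nonneg (Q i j)) (Finset.mem_univ i)

theorem isCompact_closure_orbit : IsCompact (closure (orbit Q₀)) := by
  refine Metric.isCompact_of_isClosed_isBounded isClosed_closure ?_
  refine (Metric.isBounded_Icc (fun _ _ => -1 : Fin n → Fin n → ℝ) (fun _ _ => 1)).subset ?_
  intro Q hQ
  have h := abs_entry_le_one (transpose_mul_self_of_mem_closure hQ)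
  exact ⟨fun i j => (abs_le.1 (h i j)).1, fun i j => (abs_le.1 (h i j)).2⟩

theorem mem_SO_of_mem_closure (h₀ : 0 < Q₀.det) (hQ : Q ∈ closure (orbit Q₀)) :
    Q ∈ Matrix.specialOrthogonalGroup (Fin n) ℝ := by
  refine mem_SO_iff.2 ⟨transpose_mul_self_of_mem_closure hQ, ?_⟩
  have hc : IsClosed {Q : Matrix (Fin n) (Fin n) ℝ | Q.det = 1} :=
    isClosed_eq continuous_id.matrix_det continuous_const
  refine closure_minimal ?_ hc hQ
  rintro Q ⟨t, h⟩
  exact h.det_eq_one h₀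

theorem continuous_conj (lam : Fin n → ℝ) :
    Continuous fun Q : Matrix (Fin n) (Fin n) ℝ => Qᵀ * Matrix.diagonal lam * Q :=
  (continuous_id.matrix_transpose.matrix_mul continuous_const).matrix_mul continuous_id

theorem continuous_moment (lam : Fin n → ℝ) : Continuous (moment lam) :=
  continuous_pi fun i => continuous_finsetSum _ fun a _ =>
    continuous_const.mul ((continuous_id.matrix_elem i a).pow 2)

/-- The orbit closure is compact, being a closed set of orthogonal matrices, so its image is already
closed. -/
theorem closure_slice (hlam : Function.Injective lam)
    (h₀ : Q₀ ∈ Matrix.specialOrthogonalGroup (Fin n) ℝ) :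
    closure (slice (Q₀ᵀ * Matrix.diagonal lam * Q₀)) =
      (fun Q => Qᵀ * Matrix.diagonal lam * Q) '' closure (orbit Q₀) := by
  rw [slice_eq_image hlam h₀]
  refine Set.Subset.antisymm (closure_minimal (Set.image_mono subset_closure)
    (isCompact_closure_orbit.image (continuous_conj lam)).isClosed)
    (image_closure_subset_closure_image (continuous_conj lam))

/-- Every point of the permutohedron that can be moved in all root directions is in the image of
the orbit. -/
theorem exists_orbitMoment_eq (hlam : ∀ a, lam a = C + ∑ j ∈ Finset.Ici a, c j)
    (hc : ∀ j, 0 < c j) (hw : ∀ j f, Function.Injective f → 0 < minorWeight Q₀ j f)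
    (h₀ : Q₀.det ≠ 0) {z : Fin n → ℝ} (hz : z ∈ permutohedron lam) {ε : ℝ} (hε : 0 < ε)
    (hx : ∀ i j, z + ε • (Pi.single i (1 : ℝ) - Pi.single j (1 : ℝ)) ∈ permutohedron lam) :
    ∃ t, extendedMoment (minorWeight Q₀) c C t = z ∧
      orbitMoment (minorWeight Q₀) c C t = z := by
  obtain ⟨t, ht⟩ := exists_extendedMoment_eq (w := minorWeight Q₀)
    (fun j f => sq_nonneg _) hw hc hlam hε hx
  exact ⟨t, ht, orbitMoment_eq_of_extendedMoment_eq_add hlam h₀ (s := 0)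
    (fun i => by rw [ht, add_zero]) (sum_eq_of_mem_permutohedron hz)⟩

theorem bfrHomeoOntoPermutohedron_slice (hanti : StrictAnti lam)
    (h₀ : Q₀ ∈ Matrix.specialOrthogonalGroup (Fin n) ℝ)
    (hgen : ∀ (j : Fin n) (f : Fin (j + 1) → Fin n), Function.Injective f →
      minor Q₀ (Nat.succ_le_of_lt j.2) f ≠ 0) :
    BFRHomeoOntoPermutohedron lam (slice (Q₀ᵀ * Matrix.diagonal lam * Q₀)) := by
  have hinj := hanti.injective
  obtain ⟨C, c, hc, hlam⟩ := exists_fundamental_weights hanti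
  have hdet : 0 < Q₀.det := by rw [(mem_SO_iff.1 h₀).2]; exact one_pos
  have hw : ∀ j f, Function.Injective f → 0 < minorWeight Q₀ j f := fun j f hf => by
    have := hgen j f hf
    rw [minorWeight]; positivity
  have hw0 : ∀ j f, 0 ≤ minorWeight Q₀ j f := fun j f => sq_nonneg _
  have hcl := closure_slice hinj h₀
  have hsl := slice_eq_image hinj h₀
  set X := slice (Q₀ᵀ * Matrix.diagonal lam * Q₀) with hX
  have hF : ∀ Q ∈ closure (orbit Q₀), bfrMap lam (Qᵀ * Matrix.diagonal lam * Q) = moment lam Q :=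
    fun Q hQ => bfrMap_eq_moment hinj (mem_SO_of_mem_closure hdet hQ)
  have hiso : closure X ⊆ isospectral lam := by
    rw [hcl]
    rintro _ ⟨Q, hQ, rfl⟩
    exact (mem_isospectral_iff lam _).2 ⟨Q, mem_SO_of_mem_closure hdet hQ, rfl⟩
  have hinjOn : Set.InjOn (bfrMap lam) (closure X) := by
    rw [hcl]
    rintro _ ⟨Q, hQ, rfl⟩ _ ⟨P, hP, rfl⟩ h
    simp only at h
    rw [hF Q hQ, hF P hP] at h
    rw [moment_injOn_closure hanti hgen hQ hP h]
  have hmapsTo : ∀ T ∈ closure X, bfrMap lam T ∈ permutohedron lam := by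
    rw [hcl]
    rintro _ ⟨Q, hQ, rfl⟩
    simp only
    rw [hF Q hQ]
    exact moment_mem_permutohedron (transpose_mul_self_of_mem_closure hQ)
  have horb : ∀ t, orbitPoint Q₀ t ∈ orbit Q₀ := fun t =>
    ⟨t, isOrbitPoint_orbitPoint hdet.ne' t⟩
  have hXorb : ∀ t, (orbitPoint Q₀ t)ᵀ * Matrix.diagonal lam * orbitPoint Q₀ t ∈ X := fun t => by
    rw [hsl]; exact ⟨_, horb t, rfl⟩
  have hForb : ∀ t, bfrMap lam ((orbitPoint Q₀ t)ᵀ * Matrix.diagonal lam * orbitPoint Q₀ t) =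
      orbitMoment (minorWeight Q₀) c C t := fun t => by
    rw [hF _ (subset_closure (horb t)), (isOrbitPoint_orbitPoint hdet.ne' t).moment_eq hlam]
  have hrel : ∀ T ∈ X, bfrMap lam T ∈ intrinsicInterior ℝ (permutohedron lam) := by
    rw [hsl]
    rintro _ ⟨Q, ⟨t, hQ⟩, rfl⟩
    simp only
    rw [hF _ (subset_closure ⟨t, hQ⟩)]
    obtain ⟨U, hU, htU, σ, -, hσ⟩ := exists_local_inverse (C := C) hw0 hw hc t
    -- The extended moment at `t` is the moment shifted by `∑ t`. Pulling `U` back by this shift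
    -- gives a neighbourhood of the moment whose points of the right trace are all attained.
    have hsh : Continuous fun z : Fin n → ℝ => fun i => z i + ∑ k, t k := by fun_prop
    refine mem_intrinsicInterior_of_isOpen (hU.preimage hsh) ?_ (moment_mem_permutohedron hQ.1) ?_
    · rw [hQ.moment_eq hlam]; exact htU
    · intro z hz hsum
      have h1 := hσ _ hz
      have h2 := orbitMoment_eq_of_extendedMoment_eq_add hlam hdet.ne' (fun i => congrFun h1 i) hsum
      rw [← h2, ← (isOrbitPoint_orbitPoint hdet.ne' _).moment_eq hlam]
      exact moment_mem_permutohedron (isOrbitPoint_orbitPoint hdet.ne' _).1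
  have hsurj : ∀ z ∈ intrinsicInterior ℝ (permutohedron lam),
      ∃ t, extendedMoment (minorWeight Q₀) c C t = z ∧
        orbitMoment (minorWeight Q₀) c C t = z := by
    intro z hz
    obtain ⟨ε, hε, h⟩ := exists_shift_of_mem_intrinsicInterior hinj hz
    exact exists_orbitMoment_eq hlam hc hw hdet.ne' (intrinsicInterior_subset hz) hε h
  have hsurj' : permutohedron lam ⊆ moment lam '' closure (orbit Q₀) := by
    intro x hx
    have hK : IsClosed (moment lam '' closure (orbit Q₀)) :=
      (isCompact_closure_orbit.image (continuous_moment lam)).isClosed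
    have hconv : Convex ℝ (permutohedron lam) := convex_convexHull ℝ _
    have hz₀ := hrel _ (hXorb 0)
    set z₀ := bfrMap lam ((orbitPoint Q₀ 0)ᵀ * Matrix.diagonal lam * orbitPoint Q₀ 0)
    obtain ⟨ε, hε, h⟩ := exists_shift_of_mem_intrinsicInterior hinj hz₀
    -- Points strictly between `x` and the relative interior point `z₀` can be shifted by `s * ε`
    -- along all roots, so the orbit reaches them. Letting `s` tend to zero reaches `x`, because the
    -- image is closed.
    have hmem : ∀ s ∈ Set.Ioo (0 : ℝ) 1, (1 - s) • x + s • z₀ ∈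
        moment lam '' closure (orbit Q₀) := by
      rintro s ⟨hs0, hs1⟩
      obtain ⟨t, -, ht⟩ := exists_orbitMoment_eq (Q₀ := Q₀) hlam hc hw hdet.ne'
        (hconv hx (intrinsicInterior_subset hz₀) (sub_nonneg.2 hs1.le) hs0.le (by ring))
        (mul_pos hs0 hε) fun i j => by
          have := hconv hx (h i j) (sub_nonneg.2 hs1.le) hs0.le (by ring)
          rwa [smul_add, ← add_assoc, smul_smul] at this
      refine ⟨_, subset_closure (horb t), ?_⟩
      rw [(isOrbitPoint_orbitPoint hdet.ne' t).moment_eq hlam, ht]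
    have hlim : Filter.Tendsto (fun s : ℝ => (1 - s) • x + s • z₀) (nhdsWithin 0 (Set.Ioi 0))
        (nhds x) := by
      have hcont : Continuous fun s : ℝ => (1 - s) • x + s • z₀ := by fun_prop
      have := (hcont.tendsto 0).mono_left (nhdsWithin_le_nhds (s := Set.Ioi 0))
      simpa using this
    exact hK.mem_of_tendsto hlim
      (Filter.mem_of_superset (Ioo_mem_nhdsGT one_pos) hmem)
  refine ⟨hiso, ?_, ?_⟩
  · have hcompact : IsCompact (closure X) := by
      rw [hcl]; exact isCompact_closure_orbit.image (continuous_conj lam)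
    have := isCompact_iff_compactSpace.1 hcompact
    let φ : closure X → permutohedron lam := fun T => ⟨bfrMap lam T, hmapsTo T T.2⟩
    have hφ : Function.Bijective φ := by
      constructor
      · intro T T' h
        exact Subtype.ext (hinjOn T.2 T'.2 (congrArg Subtype.val h))
      · rintro ⟨x, hx⟩
        obtain ⟨Q, hQ, hQx⟩ := hsurj' hx
        refine ⟨⟨Qᵀ * Matrix.diagonal lam * Q, hcl ▸ ⟨Q, hQ, rfl⟩⟩, Subtype.ext ?_⟩
        exact (hF Q hQ).trans hQx
    have hφc : Continuous (Equiv.ofBijective φ hφ) := by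
      refine Continuous.subtype_mk ?_ _
      have h1 : (fun T : closure X => bfrMap lam (T : Matrix (Fin n) (Fin n) ℝ)) =
          fun T : closure X => bfrPoly lam T := funext fun T =>
        (bfrPoly_eq_bfrMap hinj (hiso T.2)).symm
      rw [h1]
      exact (contDiff_bfrPoly lam).continuous.comp continuous_subtype_val
    exact ⟨Continuous.homeoOfEquivCompactToT2 hφc, fun T => rfl⟩
  · have hbij : Set.BijOn (bfrMap lam) X (intrinsicInterior ℝ (permutohedron lam)) := by
      refine ⟨hrel, hinjOn.mono subset_closure, fun z hz => ?_⟩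
      obtain ⟨t, -, ht⟩ := hsurj z hz
      exact ⟨_, hXorb t, (hForb t).trans ht⟩
    refine ⟨hbij, ?_, Function.invFunOn (bfrMap lam) X, hbij.invOn_invFunOn, ?_⟩
    · intro T _
      refine ⟨Set.univ, isOpen_univ, Set.mem_univ _, bfrPoly lam,
        (contDiff_bfrPoly lam).contDiffOn, fun S hS => ?_⟩
      exact (bfrPoly_eq_bfrMap hinj (hiso (subset_closure hS.1))).symm
    · intro z hz
      obtain ⟨t, ht, -⟩ := hsurj z hz
      -- The local right inverse is smooth on an ambient open set. On the relative interior the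
      -- trace condition removes the shift, so composing it with the orbit parametrization gives the
      -- inverse of the BFR map there.
      obtain ⟨U, hU, htU, σ, hσs, hσ⟩ := exists_local_inverse (C := C) hw0 hw hc t
      refine ⟨U, hU, ht ▸ htU, fun y => (orbitPoint Q₀ (σ y))ᵀ * Matrix.diagonal lam *
        orbitPoint Q₀ (σ y), fun y hy => ?_, ?_⟩
      · have h1 : ContDiffAt ℝ ∞ σ y := (hσs y hy).contDiffAt (hU.mem_nhds hy)
        have h2 : ContDiffAt ℝ ∞ (fun y => orbitPoint Q₀ (σ y)) y :=
          ContDiffAt.comp (g := orbitPoint Q₀) y (contDiffAt_orbitPoint hdet.ne' (σ y)) h1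
        exact (contDiffAt_matrix_mul (contDiffAt_matrix_mul (contDiffAt_matrix_transpose h2)
          contDiffAt_const) h2).contDiffWithinAt
      · rintro y ⟨hy, hyU⟩
        have h1 := hσ y hyU
        have h2 := orbitMoment_eq_of_extendedMoment_eq_add hlam hdet.ne' (t := σ y) (s := 0)
          (fun i => by rw [h1, add_zero])
          (sum_eq_of_mem_permutohedron (intrinsicInterior_subset hy))
        have h3 := hForb (σ y)
        rw [h2] at h3
        have h4 := hbij.invOn_invFunOn.1 (hXorb (σ y))
        rw [h3] at h4
        exact h4

end Slice

/-! ### Jacobi matrices and the Vandermonde flag. -/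

section Jacobi

variable {n : ℕ} {lam : Fin n → ℝ} {J R Q : Matrix (Fin n) (Fin n) ℝ}

/-- Upper Hessenberg matrices with positive subdiagonal. -/
def IsPosHessenberg (H : Matrix (Fin n) (Fin n) ℝ) : Prop :=
  (∀ i j : Fin n, (j : ℕ) + 1 < i → H i j = 0) ∧ ∀ i j : Fin n, (j : ℕ) + 1 = i → 0 < H i j

theorem IsJacobi.isPosHessenberg (hJ : IsJacobi J) : IsPosHessenberg J :=
  ⟨fun i j h => by rw [← hJ.1.apply]; exact hJ.2.1 j i h,
    fun i j h => by rw [← hJ.1.apply]; exact hJ.2.2 j i h⟩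

theorem IsPosHessenberg.isJacobi (h : IsPosHessenberg J) (hs : J.IsSymm) : IsJacobi J :=
  ⟨hs, fun i j hij => by rw [← hs.apply]; exact h.1 j i hij,
    fun i j hij => by rw [← hs.apply]; exact h.2 j i hij⟩

theorem IsPosHessenberg.mul_upPos {H : Matrix (Fin n) (Fin n) ℝ} (h : IsPosHessenberg H)
    (hR : R ∈ upPos n) : IsPosHessenberg (H * R) := by
  constructor
  · intro i j hij
    rw [Matrix.mul_apply]
    refine Finset.sum_eq_zero fun a _ => ?_
    rcases lt_or_ge j a with ha | ha
    · rw [hR.1 _ _ ha, mul_zero]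
    · rw [h.1 _ _ (by have : a.1 ≤ j.1 := ha; omega), zero_mul]
  · intro i j hij
    rw [Matrix.mul_apply, Finset.sum_eq_single j]
    · exact mul_pos (h.2 i j hij) (hR.2 j)
    · intro a _ ha
      rcases lt_or_gt_of_ne ha with ha | ha
      · rw [h.1 _ _ (by have : a.1 < j.1 := ha; omega), zero_mul]
      · rw [hR.1 _ _ ha, mul_zero]
    · simp

theorem IsPosHessenberg.upPos_mul {H : Matrix (Fin n) (Fin n) ℝ} (h : IsPosHessenberg H)
    (hR : R ∈ upPos n) : IsPosHessenberg (R * H) := by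
  constructor
  · intro i j hij
    rw [Matrix.mul_apply]
    refine Finset.sum_eq_zero fun a _ => ?_
    rcases lt_or_ge a i with ha | ha
    · rw [hR.1 _ _ ha, zero_mul]
    · rw [h.1 _ _ (by have : i.1 ≤ a.1 := ha; omega), mul_zero]
  · intro i j hij
    rw [Matrix.mul_apply, Finset.sum_eq_single i]
    · exact mul_pos (hR.2 i) (h.2 i j hij)
    · intro a _ ha
      rcases lt_or_gt_of_ne ha with ha | ha
      · rw [hR.1 _ _ ha, zero_mul]
      · rw [h.1 _ _ (by have : i.1 < a.1 := ha; omega), mul_zero]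
    · simp

/-- The first column of the `j`-th power of a positive Hessenberg matrix ends in row `j`. -/
theorem IsPosHessenberg.pow_apply {H : Matrix (Fin n) (Fin n) ℝ} (h : IsPosHessenberg H)
    (hn : 0 < n) (j : ℕ) :
    (∀ i : Fin n, j < i → (H ^ j) i ⟨0, hn⟩ = 0) ∧
      ∀ i : Fin n, (i : ℕ) = j → 0 < (H ^ j) i ⟨0, hn⟩ := by
  induction j with
  | zero =>
    refine ⟨fun i hi => ?_, fun i hi => ?_⟩
    · rw [pow_zero, Matrix.one_apply_ne]
      rintro rfl
      exact lt_irrefl _ hi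
    · have : i = ⟨0, hn⟩ := Fin.ext hi
      rw [this, pow_zero, Matrix.one_apply_eq]; exact one_pos
  | succ j ih =>
    refine ⟨fun i hi => ?_, fun i hi => ?_⟩
    · rw [pow_succ', Matrix.mul_apply]
      refine Finset.sum_eq_zero fun a _ => ?_
      rcases lt_or_ge j a.1 with ha | ha
      · rw [ih.1 a ha, mul_zero]
      · rw [h.1 i a (by omega), zero_mul]
    · rw [pow_succ', Matrix.mul_apply, Finset.sum_eq_single ⟨j, by omega⟩]
      · exact mul_pos (h.2 _ _ hi.symm) (ih.2 _ rfl)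
      · intro a _ ha
        have ha' : a.1 ≠ j := fun e => ha (Fin.ext e)
        rcases lt_or_gt_of_ne ha' with ha | ha
        · rw [h.1 i a (by omega), zero_mul]
        · rw [ih.1 a ha, mul_zero]
      · simp

/-- The eigenvector matrix of a Jacobi matrix is the orthogonal factor of a Vandermonde matrix with
scaled rows. -/
theorem IsPosHessenberg.exists_mul_eq_vandermonde (hQ : Qᵀ * Q = 1)
    (h : IsPosHessenberg (Qᵀ * Matrix.diagonal lam * Q)) :
    ∃ R ∈ upPos n, ∃ q : Fin n → ℝ, (∀ i, q i ≠ 0) ∧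
      Q * R = Matrix.diagonal q * Matrix.vandermonde lam := by
  rcases n.eq_zero_or_pos with rfl | hn
  · exact ⟨1, ⟨fun i => i.elim0, fun i => i.elim0⟩, 1, fun i => i.elim0, by ext i; exact i.elim0⟩
  have hQ' : Q * Qᵀ = 1 := mul_eq_one_comm.1 hQ
  set J := Qᵀ * Matrix.diagonal lam * Q with hJ
  -- The Krylov matrix: its columns are the powers of `J` applied to the first basis vector. Since
  -- `Q` diagonalizes `J`, row `i` of `Q * R` consists of the powers of `lam i` scaled by `Q i 0`.
  set R : Matrix (Fin n) (Fin n) ℝ := Matrix.of fun i j => (J ^ (j : ℕ)) i ⟨0, hn⟩ with hR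
  have hRup : R ∈ upPos n :=
    ⟨fun i j hij => (h.pow_apply hn j).1 i hij, fun i => (h.pow_apply hn i).2 i rfl⟩
  have hpow : ∀ k : ℕ, Q * J ^ k = Matrix.diagonal (fun i => lam i ^ k) * Q := by
    intro k
    induction k with
    | zero => simp
    | succ k ih =>
      rw [pow_succ, ← Matrix.mul_assoc, ih, hJ]
      calc Matrix.diagonal (fun i => lam i ^ k) * Q * (Qᵀ * Matrix.diagonal lam * Q)
          = Matrix.diagonal (fun i => lam i ^ k) * (Q * Qᵀ) * Matrix.diagonal lam * Q := by
            simp only [Matrix.mul_assoc]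
        _ = _ := by rw [hQ', Matrix.mul_one, Matrix.diagonal_mul_diagonal]; simp only [pow_succ]
  have heq : Q * R = Matrix.diagonal (fun i => Q i ⟨0, hn⟩) * Matrix.vandermonde lam := by
    ext i j
    have := congrFun (congrFun (hpow j) i) ⟨0, hn⟩
    rw [Matrix.diagonal_mul] at this
    rw [Matrix.diagonal_mul, Matrix.vandermonde_apply, mul_comm, ← this, Matrix.mul_apply,
      Matrix.mul_apply]
    rfl
  refine ⟨R, hRup, _, ?_, heq⟩
  -- The left side is invertible, so the product of the first-column entries of `Q` cannot vanish.
  have hd := congrArg Matrix.det heq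
  rw [Matrix.det_mul, Matrix.det_mul, Matrix.det_diagonal] at hd
  have hQd : Q.det ≠ 0 := fun e => by
    have := congrArg Matrix.det hQ
    rw [Matrix.det_mul, e, mul_zero, Matrix.det_one] at this
    exact zero_ne_one this
  have hne := hd ▸ mul_ne_zero hQd (det_pos_of_mem_upPos hRup).ne'
  exact fun i => Finset.prod_ne_zero_iff.1 (left_ne_zero_of_mul hne) i (Finset.mem_univ i)

theorem minor_vandermonde {k : ℕ} (hk : k ≤ n) (f : Fin k → Fin n) :
    minor (Matrix.vandermonde lam) hk f = (Matrix.vandermonde fun a => lam (f a)).det := rfl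

/-- Up to nonzero factors, the minors of `Q` on first columns are those of a Vandermonde matrix,
which are Vandermonde determinants with distinct nodes. -/
theorem IsPosHessenberg.minor_ne_zero (hlam : Function.Injective lam) (hQ : Qᵀ * Q = 1)
    (h : IsPosHessenberg (Qᵀ * Matrix.diagonal lam * Q)) {k : ℕ} (hk : k ≤ n)
    {f : Fin k → Fin n} (hf : Function.Injective f) : minor Q hk f ≠ 0 := by
  obtain ⟨R, hR, q, hq, he⟩ := h.exists_mul_eq_vandermonde hQ
  have h1 := minor_mul_upper Q hR.1 hk f
  rw [he, minor_diagonal_mul, minor_vandermonde] at h1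
  have h2 : (∏ a, q (f a)) * (Matrix.vandermonde fun a => lam (f a)).det ≠ 0 :=
    mul_ne_zero (Finset.prod_ne_zero_iff.2 fun a _ => hq _)
      (Matrix.det_vandermonde_ne_zero_iff.2 (hlam.comp hf))
  rw [h1] at h2
  exact left_ne_zero_of_mul h2

theorem spectrallyComplete_of_mem_jacobiSet (hlam : Function.Injective lam)
    (hJ : J ∈ jacobiSet lam) : SpectrallyComplete lam J := by
  obtain ⟨Q, hQ, rfl⟩ := (mem_isospectral_iff lam J).1 hJ.2
  exact ⟨Q, ⟨hQ, rfl⟩, fun k hk rows =>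
    hJ.1.isPosHessenberg.minor_ne_zero hlam (mem_SO_iff.1 hQ).1 hk rows.injective⟩

/-- Conjugation by `upPos` keeps the Hessenberg shape and the positive subdiagonal, and symmetry
restores tridiagonality. Conversely, the eigenvector matrices of two Jacobi matrices both carry the
Vandermonde flag up to row scaling, so they differ by a diagonal action. -/
theorem slice_eq_jacobiSet (hJ : J ∈ jacobiSet lam) :
    slice J = jacobiSet lam := by
  obtain ⟨Q, hQ, rfl⟩ := (mem_isospectral_iff lam J).1 hJ.2
  have hH := hJ.1.isPosHessenberg
  apply Set.Subset.antisymm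
  · rintro T ⟨⟨P, hP, hT⟩, R, hR, hT'⟩
    have hTs : T.IsSymm := by
      rw [hT, Matrix.IsSymm, Matrix.transpose_mul, Matrix.transpose_mul, hJ.1.1.eq,
        Matrix.transpose_transpose, ← Matrix.mul_assoc]
    refine ⟨IsPosHessenberg.isJacobi ?_ hTs, (mem_isospectral_iff lam T).2 ⟨Q * P, ?_, ?_⟩⟩
    · rw [hT']
      exact (hH.upPos_mul hR).mul_upPos (inv_mem_upPos hR)
    · exact mul_mem hQ hP
    · rw [hT, Matrix.transpose_mul]
      simp only [Matrix.mul_assoc]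
  · rintro T hT
    obtain ⟨Q', hQ', rfl⟩ := (mem_isospectral_iff lam T).1 hT.2
    obtain ⟨R, hR, q, hq, he⟩ := hH.exists_mul_eq_vandermonde (mem_SO_iff.1 hQ).1
    obtain ⟨R', hR', q', hq', he'⟩ :=
      hT.1.isPosHessenberg.exists_mul_eq_vandermonde (mem_SO_iff.1 hQ').1
    have hm : Q' * (R' * R⁻¹) = Matrix.diagonal (fun i => q' i / q i) * Q := by
      have h1 : Matrix.diagonal q' =
          Matrix.diagonal (fun i => q' i / q i) * Matrix.diagonal q := by
        rw [Matrix.diagonal_mul_diagonal]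
        congr 1; funext i
        rw [div_mul_cancel₀ _ (hq i)]
      rw [← Matrix.mul_assoc, he', h1, Matrix.mul_assoc _ (Matrix.diagonal q), ← he,
        Matrix.mul_assoc, Matrix.mul_assoc, Matrix.mul_nonsing_inv _ (isUnit_det_of_mem_upPos hR),
        Matrix.mul_one]
    obtain ⟨t, P, hP, hPe⟩ := exists_isOrbitPoint_of_mul_eq (lam := lam) (mem_SO_iff.1 hQ').1
      (mul_mem_upPos hR' (inv_mem_upPos hR)) (fun i => div_ne_zero (hq' i) (hq i)) hm
    rw [← hPe]
    exact mem_slice_of_mul_eq hQ hP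

/-- There is a Jacobi matrix with any given simple spectrum. -/
theorem jacobiSet_nonempty (hlam : Function.Injective lam) : (jacobiSet lam).Nonempty := by
  set V := Matrix.vandermonde lam with hV
  have hVd : V.det ≠ 0 := Matrix.det_vandermonde_ne_zero_iff.2 hlam
  obtain ⟨hQ, R, hR, he⟩ := orthFactor_spec hVd
  set Q := orthFactor V
  have hQ' : Q * Qᵀ = 1 := mul_eq_one_comm.1 hQ
  have hs : (Qᵀ * Matrix.diagonal lam * Q).IsSymm := by
    simp [Matrix.IsSymm, Matrix.transpose_mul, Matrix.mul_assoc]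
  -- Multiplying by `Λ` shifts the columns of the Vandermonde matrix, so `M` is a companion matrix.
  -- Only its last column is not a basis vector, and that column does not affect the Hessenberg
  -- conditions.
  set M := V⁻¹ * (Matrix.diagonal lam * V) with hM
  have hMH : IsPosHessenberg M := by
    have hcol : ∀ i j : Fin n, (hj : (j : ℕ) + 1 < n) →
        M i j = if i = ⟨j + 1, hj⟩ then 1 else 0 := by
      intro i j hj
      have h1 := congrFun (congrFun (Matrix.nonsing_inv_mul V hVd.isUnit) i) ⟨j + 1, hj⟩
      rw [Matrix.mul_apply, Matrix.one_apply] at h1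
      rw [hM, Matrix.mul_apply, ← h1]
      refine Finset.sum_congr rfl fun a _ => ?_
      rw [Matrix.diagonal_mul, hV, Matrix.vandermonde_apply, Matrix.vandermonde_apply, pow_succ']
    refine ⟨fun i j hij => ?_, fun i j hij => ?_⟩
    · rw [hcol i j (by omega), if_neg]
      exact fun e => hij.ne (congrArg Fin.val e).symm
    · rw [hcol i j (by omega), if_pos (Fin.ext hij.symm)]
      exact one_pos
  have hconj : Qᵀ * Matrix.diagonal lam * Q = R * M * R⁻¹ := by
    have hu := isUnit_det_of_mem_upPos hR
    have h1 : R * V⁻¹ = Qᵀ := by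
      calc R * V⁻¹ = (Qᵀ * Q) * R * V⁻¹ := by rw [hQ, Matrix.one_mul]
        _ = Qᵀ * (Q * R * V⁻¹) := by simp only [Matrix.mul_assoc]
        _ = Qᵀ := by rw [he, Matrix.mul_nonsing_inv _ hVd.isUnit, Matrix.mul_one]
    rw [hM, ← Matrix.mul_assoc R, h1, ← he]
    simp only [Matrix.mul_assoc]
    rw [Matrix.mul_nonsing_inv _ hu, Matrix.mul_one]
  refine ⟨Qᵀ * Matrix.diagonal lam * Q, IsPosHessenberg.isJacobi ?_ hs, hs, ?_⟩
  · rw [hconj]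
    exact (hMH.upPos_mul hR).mul_upPos (inv_mem_upPos hR)
  · rw [Matrix.mul_assoc, Matrix.charpoly_mul_comm, Matrix.mul_assoc, hQ', Matrix.mul_one]

end Jacobi

end BFR

theorem theorem3 {n : ℕ} (lam : Fin n → ℝ) (hlam : StrictAnti lam) :
    (∀ S : Matrix (Fin n) (Fin n) ℝ, BFR.SpectrallyComplete lam S →
      BFR.BFRHomeoOntoPermutohedron lam (BFR.slice S)) ∧
    (∀ J ∈ BFR.jacobiSet lam, BFR.SpectrallyComplete lam J ∧ BFR.slice J = BFR.jacobiSet lam) ∧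
    BFR.BFRHomeoOntoPermutohedron lam (BFR.jacobiSet lam) := by
  have h1 : ∀ S : Matrix (Fin n) (Fin n) ℝ, BFR.SpectrallyComplete lam S →
      BFR.BFRHomeoOntoPermutohedron lam (BFR.slice S) := by
    rintro S ⟨Q, ⟨hQ, rfl⟩, hgen⟩
    exact BFR.bfrHomeoOntoPermutohedron_slice hlam hQ fun j f hf =>
      BFR.minor_ne_zero_of_rows _ (hgen _ (Nat.succ_le_of_lt j.2)) hf
  have h2 := fun J (hJ : J ∈ BFR.jacobiSet lam) =>
    And.intro (BFR.spectrallyComplete_of_mem_jacobiSet hlam.injective hJ)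
      (BFR.slice_eq_jacobiSet hJ)
  refine ⟨h1, h2, ?_⟩
  -- One Jacobi matrix suffices: its slice is the whole Jacobi set, to which the first statement
  -- applies.
  obtain ⟨J, hJ⟩ := BFR.jacobiSet_nonempty hlam.injective
  rw [← (h2 J hJ).2]
  exact h1 J (h2 J hJ).1
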